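/- Let $G$ be a finite group, and let $\widehat{G}$ be its unitary dual, i.e. the set of unitary equivalence classes of irreducible unitary representations $\pi$ of $G$, with $d_\pi$ denoting the dimension of $\pi$. Then $$\operatorname{AD}(G)=\frac{1}{|G|}\sum_{\pi\in\widehat{G}} d_\pi^{\,3}=\operatorname{AM}(\operatorname{A}(G)).$$ Here the notation is as follows. * For a discrete group $\Gamma$, the Fourier–Stieltjes algebra $\operatorname{B}(\Gamma)$ is the set of all coefficient functions $x\mapsto\langle\theta(x)\xi,\eta\rangle$ of unitary representations $\theta$ of $\Gamma$ on Hilbert spaces, normed by $$\|f\|_{\operatorname{B}(\Gamma)}=\sup\Big\{\Big|\sum_{x\in\Gamma}f(x)b(x)\Big| : b\in c_{00}(\Gamma),\ \|b\|_{\mathrm{C}^*(\Gamma)}\le 1\Big\},\qquad \|b\|_{\mathrm{C}^*(\Gamma)}=\sup_\theta\Big\|\sum_{x\in\Gamma} b(x)\theta(x)\Big\|,$$ where $c_{00}(\Gamma)$ is the space of finitely supported functions $\Gamma\to\mathbb{C}$ and the last supremum is over all unitary representations $\theta$ of $\Gamma$. * The anti-diagonal constant $\operatorname{AD}(\Gamma)$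 is the norm in $\operatorname{B}(\Gamma\times\Gamma)$ of the indicator function of the anti-diagonal $\{(x,x^{-1}) : x\in\Gamma\}$, and $\operatorname{AD}(\Gamma)=\infty$ if this function does not belong to $\operatorname{B}(\Gamma\times\Gamma)$. * The Fourier algebra $\operatorname{A}(\Gamma)$ of the discrete group $\Gamma$ is the closure in $\operatorname{B}(\Gamma)$ of the finitely supported functions, a Banach algebra under pointwise operations and the norm of $\operatorname{B}(\Gamma)$. For finite $G$ it consists of all functions on $G$. * For a Banach algebra $A$, a virtual diagonal is an element $M$ of the bidual $(A\mathbin{\widehat{\otimes}}A)^{**}$ of the projective tensor product with $a\cdot M=M\cdot a$ and $a\cdot\Delta^{**}(M)=a$ for all $a\in A$, where $\Delta(b\otimes c)=bc$, $a\cdot(b\otimes c)=ab\otimes c$ and $(b\otimes c)\cdot a=b\otimes ca$. The amenability constant $\operatorname{AM}(A)\in[0,\infty]$ is the infimum of the norms of the virtual diagonals of $A$ (and $\infty$ if there are none). -/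

import Mathlib

open scoped ENNReal InnerProductSpace TensorProduct

set_option maxSynthPendingDepth 3

/- Prefer the inner product of an inner product space to the one that comes from the structure of
a Hilbert `C*`-module over `ℂ`. -/
attribute [instance 2000] InnerProductSpace.toInner

noncomputable section

universe u

/-! ### Unitary representations of discrete groups -/

/-- A unitary representation of the discrete group `Γ` on a (complex) Hilbert space. The group
`space ≃ₗᵢ[ℂ] space` of surjective linear isometries is the unitary group of `space`.

The space is taken in the universe of `Γ`. Every unitary representation is an orthogonal sum of
cyclic ones, and every cyclic one is unitarily equivalent to one on a space in this universe, so
that the notions below (coefficient functions, the norm of the full group algebra, irreducible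
representations up to equivalence) do not depend on this choice. -/
structure UnitaryRep (Γ : Type u) [Group Γ] where
  /-- the Hilbert space -/
  space : Type u
  [normedAddCommGroup : NormedAddCommGroup space]
  [innerProductSpace : InnerProductSpace ℂ space]
  [completeSpace : CompleteSpace space]
  /-- the action of the group by unitary operators -/
  hom : Γ →* (space ≃ₗᵢ[ℂ] space)

attribute [instance] UnitaryRep.normedAddCommGroup UnitaryRep.innerProductSpace
  UnitaryRep.completeSpace

namespace UnitaryRep

variable {Γ : Type u} [Group Γ]

/-- The coefficient function `x ↦ ⟨π(x)ξ, η⟩` (this inner product is linear in the first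
variable, Mathlib's is linear in the second). -/
def coeff (π : UnitaryRep Γ) (ξ η : π.space) : Γ → ℂ :=
  fun x => ⟪η, π.hom x ξ⟫_ℂ

/-- The operator `π(b) = ∑ₓ b(x) π(x)` for a finitely supported function `b`. -/
def eval (π : UnitaryRep Γ) (b : Γ →₀ ℂ) : π.space →L[ℂ] π.space :=
  b.sum fun x c => c • ((π.hom x).toContinuousLinearEquiv : π.space →L[ℂ] π.space)

/-- (Topological) irreducibility: the space is nonzero and has no closed invariant subspaces
other than the two trivial ones. -/
def IsIrreducible (π : UnitaryRep Γ) : Prop :=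
  Nontrivial π.space ∧
    ∀ W : Submodule ℂ π.space, IsClosed (W : Set π.space) →
      (∀ x : Γ, ∀ v ∈ W, π.hom x v ∈ W) → W = ⊥ ∨ W = ⊤

/-- Unitary equivalence of representations. -/
def Equivalent (π σ : UnitaryRep Γ) : Prop :=
  ∃ U : π.space ≃ₗᵢ[ℂ] σ.space, ∀ (x : Γ) (v : π.space), U (π.hom x v) = σ.hom x (U v)

theorem Equivalent.refl (π : UnitaryRep Γ) : π.Equivalent π :=
  ⟨LinearIsometryEquiv.refl ℂ _, fun _ _ => rfl⟩

theorem Equivalent.symm {π σ : UnitaryRep Γ} (h : π.Equivalent σ) : σ.Equivalent π := by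
  obtain ⟨U, hU⟩ := h
  refine ⟨U.symm, fun x v => ?_⟩
  rw [LinearIsometryEquiv.symm_apply_eq, hU, LinearIsometryEquiv.apply_symm_apply]

theorem Equivalent.trans {π σ τ : UnitaryRep Γ} (h : π.Equivalent σ) (h' : σ.Equivalent τ) :
    π.Equivalent τ := by
  obtain ⟨U, hU⟩ := h
  obtain ⟨V, hV⟩ := h'
  exact ⟨U.trans V, fun x v => by simp [hU, hV]⟩

end UnitaryRep

/-- Unitary equivalence on the irreducible representations. -/
instance unitaryDualSetoid (Γ : Type u) [Group Γ] :
    Setoid {π : UnitaryRep Γ // π.IsIrreducible} where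
  r π σ := π.1.Equivalent σ.1
  iseqv := ⟨fun π => .refl π.1, fun h => h.symm, fun h h' => h.trans h'⟩

/-- The unitary dual: equivalence classes of irreducible unitary representations. -/
def UnitaryDual (Γ : Type u) [Group Γ] : Type (u + 1) :=
  Quotient (unitaryDualSetoid Γ)

/-- The dimension `d_π` of an irreducible representation (all of them are finite-dimensional
when the group is finite, the only case in which this is used). -/
def UnitaryDual.dim {Γ : Type u} [Group Γ] : UnitaryDual Γ → ℕ :=
  Quotient.lift (fun π => Module.finrank ℂ π.1.space) (by
    rintro π σ ⟨U, -⟩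
    exact U.toLinearEquiv.finrank_eq)

/-! ### The Fourier–Stieltjes algebra -/

section FourierStieltjes

variable {Γ : Type u} [Group Γ]

/-- The norm of `b` in the full group C*-algebra: the supremum of `‖π(b)‖` over all unitary
representations. -/
def cstarNorm (b : Γ →₀ ℂ) : ℝ≥0∞ :=
  ⨆ π : UnitaryRep Γ, ‖π.eval b‖ₑ

/-- The pairing `∑ₓ f(x) b(x)`. -/
def fsPair (f : Γ → ℂ) (b : Γ →₀ ℂ) : ℂ :=
  b.sum fun x c => f x * c

/-- The Fourier–Stieltjes norm: the supremum of `|∑ₓ f(x) b(x)|` over the unit ball for the full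
C*-norm. -/
def fsNorm (f : Γ → ℂ) : ℝ≥0∞ :=
  ⨆ (b : Γ →₀ ℂ) (_ : cstarNorm b ≤ 1), ‖fsPair f b‖ₑ

variable (Γ) in
/-- The Fourier–Stieltjes algebra `B(Γ)`, as a set of functions: the coefficient functions of
unitary representations. -/
def fourierStieltjes : Set (Γ → ℂ) :=
  {f | ∃ (π : UnitaryRep Γ) (ξ η : π.space), f = π.coeff ξ η}

end FourierStieltjes

/-- The anti-diagonal `{(x, x⁻¹) : x ∈ Γ}`. -/
def adiag (Γ : Type u) [Group Γ] : Set (Γ × Γ) :=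
  Set.range fun x => (x, x⁻¹)

open Classical in
/-- The anti-diagonal constant: the norm of the indicator function of the anti-diagonal in
`B(Γ × Γ)`, or `∞` if this function is not in `B(Γ × Γ)`. -/
def antidiagonalConstant (Γ : Type u) [Group Γ] : ℝ≥0∞ :=
  if (adiag Γ).indicator 1 ∈ fourierStieltjes (Γ × Γ) then
    fsNorm ((adiag Γ).indicator (1 : Γ × Γ → ℂ))
  else ∞

/-! ### Facts on the Fourier–Stieltjes norm, needed for the Fourier algebra -/

section Lemmas

variable {Γ : Type u}

theorem fsPair_smul_right (f : Γ → ℂ) (t : ℂ) (b : Γ →₀ ℂ) :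
    fsPair f (t • b) = t * fsPair f b := by
  unfold fsPair
  rw [Finsupp.sum_smul_index (by simp), Finsupp.mul_sum]
  exact Finset.sum_congr rfl fun x _ => by ring

/-- The pointwise product of a function and a finitely supported function. -/
def mulFinsupp (f : Γ → ℂ) (b : Γ →₀ ℂ) : Γ →₀ ℂ :=
  Finsupp.onFinset b.support (fun x => f x * b x) fun x hx => by
    rw [Finsupp.mem_support_iff]
    exact right_ne_zero_of_mul hx

theorem fsPair_mulFinsupp (f g : Γ → ℂ) (b : Γ →₀ ℂ) :
    fsPair f (mulFinsupp g b) = fsPair (f * g) b := by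
  unfold fsPair mulFinsupp
  rw [Finsupp.onFinset_sum _ (fun _ => by simp)]
  exact Finset.sum_congr rfl fun x _ => by simp [mul_assoc]

variable [Group Γ]

theorem UnitaryRep.inner_eval (π : UnitaryRep Γ) (b : Γ →₀ ℂ) (ξ η : π.space) :
    ⟪η, π.eval b ξ⟫_ℂ = fsPair (π.coeff ξ η) b := by
  simp only [UnitaryRep.eval, fsPair, Finsupp.sum, UnitaryRep.coeff,
    sum_apply, inner_sum]
  refine Finset.sum_congr rfl fun x _ => ?_
  simp [inner_smul_right, mul_comm]

theorem UnitaryRep.eval_smul (π : UnitaryRep Γ) (t : ℂ) (b : Γ →₀ ℂ) :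
    π.eval (t • b) = t • π.eval b := by
  unfold UnitaryRep.eval
  rw [Finsupp.sum_smul_index (by simp), Finsupp.smul_sum]
  simp [mul_smul]

theorem cstarNorm_smul (t : ℂ) (b : Γ →₀ ℂ) : cstarNorm (t • b) = ‖t‖ₑ * cstarNorm b := by
  simp only [cstarNorm, UnitaryRep.eval_smul, enorm_smul, ENNReal.mul_iSup]

theorem UnitaryRep.enorm_hom_le (π : UnitaryRep Γ) (x : Γ) :
    ‖((π.hom x).toContinuousLinearEquiv : π.space →L[ℂ] π.space)‖ₑ ≤ 1 := by
  rw [← ofReal_norm]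
  refine ENNReal.ofReal_le_one.2 (ContinuousLinearMap.opNorm_le_bound _ zero_le_one fun v => ?_)
  simp

theorem cstarNorm_lt_top (b : Γ →₀ ℂ) : cstarNorm b < ∞ := by
  have h : cstarNorm b ≤ ∑ x ∈ b.support, ‖b x‖ₑ := by
    refine iSup_le fun π => ?_
    refine (enorm_sum_le _ _).trans (Finset.sum_le_sum fun x _ => ?_)
    rw [enorm_smul]
    exact mul_le_of_le_one_right' (π.enorm_hom_le x)
  exact h.trans_lt (ENNReal.sum_lt_top.2 fun x _ => enorm_lt_top)

theorem fsPair_le_of_cstarNorm_le_one (f : Γ → ℂ) {b : Γ →₀ ℂ} (hb : cstarNorm b ≤ 1) :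
    ‖fsPair f b‖ₑ ≤ fsNorm f :=
  le_iSup₂ (f := fun (b : Γ →₀ ℂ) (_ : cstarNorm b ≤ 1) => ‖fsPair f b‖ₑ) b hb

theorem fsPair_le {f : Γ → ℂ} (hf : fsNorm f < ∞) (b : Γ →₀ ℂ) :
    ‖fsPair f b‖ₑ ≤ fsNorm f * cstarNorm b := by
  rcases eq_or_ne (cstarNorm b) 0 with h0 | h0
  · rw [h0, mul_zero, nonpos_iff_eq_zero]
    by_contra hp
    obtain ⟨n, hn⟩ := ENNReal.exists_nat_mul_gt hp hf.ne
    have h1 : cstarNorm ((n : ℂ) • b) ≤ 1 := by rw [cstarNorm_smul, h0]; simp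
    have h2 := fsPair_le_of_cstarNorm_le_one f h1
    rw [fsPair_smul_right, enorm_mul] at h2
    have h3 : ‖(n : ℂ)‖ₑ = n := by
      rw [← ofReal_norm, Complex.norm_natCast, ENNReal.ofReal_natCast]
    rw [h3] at h2
    exact absurd hn (not_lt.2 h2)
  · have hC := (cstarNorm_lt_top b).ne
    set r : ℝ := (cstarNorm b).toReal with hr
    have hrpos : 0 < r := ENNReal.toReal_pos h0 hC
    have hrC : ENNReal.ofReal r = cstarNorm b := ENNReal.ofReal_toReal hC
    have h3 : ‖((r : ℂ))⁻¹‖ₑ = (cstarNorm b)⁻¹ := by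
      rw [← ofReal_norm, norm_inv, Complex.norm_real, Real.norm_of_nonneg hrpos.le,
        ENNReal.ofReal_inv_of_pos hrpos, hrC]
    have h1 : cstarNorm ((r : ℂ)⁻¹ • b) ≤ 1 := by
      rw [cstarNorm_smul, h3, ENNReal.inv_mul_cancel h0 hC]
    have h2 := fsPair_le_of_cstarNorm_le_one f h1
    rw [fsPair_smul_right, enorm_mul, h3, mul_comm, ← div_eq_mul_inv] at h2
    exact (ENNReal.div_le_iff h0 hC).1 h2

theorem fsNorm_coeff_le (π : UnitaryRep Γ) (ξ η : π.space) :
    fsNorm (π.coeff ξ η) ≤ ‖ξ‖ₑ * ‖η‖ₑ := by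
  refine iSup₂_le fun b hb => ?_
  rw [← UnitaryRep.inner_eval]
  have h1 : ‖π.eval b‖ₑ ≤ 1 := (le_iSup (fun π : UnitaryRep Γ => ‖π.eval b‖ₑ) π).trans hb
  have h2 : ‖⟪η, π.eval b ξ⟫_ℂ‖ₑ ≤ ‖η‖ₑ * ‖π.eval b ξ‖ₑ := by
    rw [← ofReal_norm, ← ofReal_norm, ← ofReal_norm, ← ENNReal.ofReal_mul (norm_nonneg _)]
    exact ENNReal.ofReal_le_ofReal (norm_inner_le_norm _ _)
  calc ‖⟪η, π.eval b ξ⟫_ℂ‖ₑ ≤ ‖η‖ₑ * (‖π.eval b‖ₑ * ‖ξ‖ₑ) :=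
        h2.trans (by gcongr; exact (π.eval b).le_opENorm ξ)
    _ ≤ ‖η‖ₑ * (1 * ‖ξ‖ₑ) := by gcongr
    _ = ‖ξ‖ₑ * ‖η‖ₑ := by rw [one_mul, mul_comm]

theorem fsNorm_lt_top {f : Γ → ℂ} (hf : f ∈ fourierStieltjes Γ) : fsNorm f < ∞ := by
  obtain ⟨π, ξ, η, rfl⟩ := hf
  exact (fsNorm_coeff_le π ξ η).trans_lt (ENNReal.mul_lt_top enorm_lt_top enorm_lt_top)

theorem enorm_apply_le_fsNorm (f : Γ → ℂ) (x : Γ) : ‖f x‖ₑ ≤ fsNorm f := by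
  have h : cstarNorm (Finsupp.single x (1 : ℂ)) ≤ 1 := by
    refine iSup_le fun π => ?_
    simpa [UnitaryRep.eval] using π.enorm_hom_le x
  simpa [fsPair] using fsPair_le_of_cstarNorm_le_one f h

theorem fsNorm_add_le (f g : Γ → ℂ) : fsNorm (f + g) ≤ fsNorm f + fsNorm g := by
  refine iSup₂_le fun b hb => ?_
  have h : fsPair (f + g) b = fsPair f b + fsPair g b := by
    simp [fsPair, add_mul, Finsupp.sum, Finset.sum_add_distrib]
  rw [h]
  exact (enorm_add_le _ _).trans (add_le_add (fsPair_le_of_cstarNorm_le_one f hb)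
    (fsPair_le_of_cstarNorm_le_one g hb))

theorem fsNorm_smul (t : ℂ) (f : Γ → ℂ) : fsNorm (t • f) = ‖t‖ₑ * fsNorm f := by
  have h (b : Γ →₀ ℂ) : fsPair (t • f) b = t * fsPair f b := by
    simp [fsPair, mul_assoc, Finsupp.sum, Finset.mul_sum]
  simp only [fsNorm, h, enorm_mul, ENNReal.mul_iSup]

theorem fsNorm_zero : fsNorm (0 : Γ → ℂ) = 0 := by
  simpa using fsNorm_smul (0 : ℂ) (0 : Γ → ℂ)

theorem fsNorm_neg (f : Γ → ℂ) : fsNorm (-f) = fsNorm f := by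
  simpa using fsNorm_smul (-1 : ℂ) f

/-- The extension of an isometry to the completion, as a function. -/
def completionMap {V : Type u} [NormedAddCommGroup V] [InnerProductSpace ℂ V]
    (T : V ≃ₗᵢ[ℂ] V) : UniformSpace.Completion V → UniformSpace.Completion V :=
  UniformSpace.Completion.map T

theorem completionMap_coe {V : Type u} [NormedAddCommGroup V] [InnerProductSpace ℂ V]
    (T : V ≃ₗᵢ[ℂ] V) (v : V) :
    completionMap T (v : UniformSpace.Completion V) = (T v : UniformSpace.Completion V) :=
  UniformSpace.Completion.map_coe T.isometry.uniformContinuous v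

theorem continuous_completionMap {V : Type u} [NormedAddCommGroup V] [InnerProductSpace ℂ V]
    (T : V ≃ₗᵢ[ℂ] V) : Continuous (completionMap T) :=
  UniformSpace.Completion.continuous_map

theorem completionMap_symm {V : Type u} [NormedAddCommGroup V] [InnerProductSpace ℂ V]
    (T T' : V ≃ₗᵢ[ℂ] V) (h : ∀ v, T' (T v) = v) (x : UniformSpace.Completion V) :
    completionMap T' (completionMap T x) = x := by
  refine UniformSpace.Completion.induction_on x
    (isClosed_eq ((continuous_completionMap T').comp (continuous_completionMap T)) continuous_id)
    fun a => ?_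
  rw [completionMap_coe, completionMap_coe, h]

theorem completionMap_add {V : Type u} [NormedAddCommGroup V] [InnerProductSpace ℂ V]
    (T : V ≃ₗᵢ[ℂ] V) (x y : UniformSpace.Completion V) :
    completionMap T (x + y) = completionMap T x + completionMap T y := by
  have hT := continuous_completionMap T
  refine UniformSpace.Completion.induction_on₂ x y
    (isClosed_eq (by fun_prop) (by fun_prop)) fun a b => ?_
  rw [← UniformSpace.Completion.coe_add, completionMap_coe, completionMap_coe,
    completionMap_coe, map_add, UniformSpace.Completion.coe_add]

theorem completionMap_smul {V : Type u} [NormedAddCommGroup V] [InnerProductSpace ℂ V]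
    (T : V ≃ₗᵢ[ℂ] V) (c : ℂ) (x : UniformSpace.Completion V) :
    completionMap T (c • x) = c • completionMap T x := by
  have hT := continuous_completionMap T
  have hc : Continuous fun x : UniformSpace.Completion V => c • x :=
    continuous_const_smul c
  have h1 : Continuous fun x => completionMap T (c • x) := hT.comp hc
  have h2 : Continuous fun x => c • completionMap T x := hc.comp hT
  refine UniformSpace.Completion.induction_on x (isClosed_eq h1 h2) fun a => ?_
  rw [← UniformSpace.Completion.coe_smul, completionMap_coe, completionMap_coe, map_smul,
    UniformSpace.Completion.coe_smul]

theorem norm_completionMap {V : Type u} [NormedAddCommGroup V] [InnerProductSpace ℂ V]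
    (T : V ≃ₗᵢ[ℂ] V) (x : UniformSpace.Completion V) : ‖completionMap T x‖ = ‖x‖ := by
  have hT := continuous_completionMap T
  refine UniformSpace.Completion.induction_on x (isClosed_eq hT.norm continuous_norm) fun a => ?_
  rw [completionMap_coe, UniformSpace.Completion.norm_coe, UniformSpace.Completion.norm_coe,
    T.norm_map]

/-- The extension of a unitary operator to the completion. -/
def completionUnitary {V : Type u} [NormedAddCommGroup V] [InnerProductSpace ℂ V]
    (T : V ≃ₗᵢ[ℂ] V) : UniformSpace.Completion V ≃ₗᵢ[ℂ] UniformSpace.Completion V where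
  toFun := completionMap T
  invFun := completionMap T.symm
  map_add' := completionMap_add T
  map_smul' := completionMap_smul T
  left_inv := completionMap_symm T T.symm T.symm_apply_apply
  right_inv := completionMap_symm T.symm T T.apply_symm_apply
  norm_map' := norm_completionMap T

theorem completionUnitary_coe {V : Type u} [NormedAddCommGroup V] [InnerProductSpace ℂ V]
    (T : V ≃ₗᵢ[ℂ] V) (v : V) :
    completionUnitary T (v : UniformSpace.Completion V) = (T v : UniformSpace.Completion V) :=
  completionMap_coe T v

/-- The tensor product of two unitary representations, on the Hilbert space tensor product. -/
def UnitaryRep.tensor (π σ : UnitaryRep Γ) : UnitaryRep Γ where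
  space := UniformSpace.Completion (π.space ⊗[ℂ] σ.space)
  hom := MonoidHom.mk'
    (fun x => completionUnitary (TensorProduct.congrIsometry (π.hom x) (σ.hom x))) (by
    intro x y
    ext z
    refine UniformSpace.Completion.induction_on z
      (isClosed_eq (LinearIsometryEquiv.continuous _) (LinearIsometryEquiv.continuous _))
      fun a => ?_
    rw [LinearIsometryEquiv.coe_mul, Function.comp_apply]
    simp only [completionUnitary_coe]
    congr 1
    induction a using TensorProduct.induction_on with
    | zero => simp
    | tmul v w => simp; rfl
    | add v w hv hw => rw [map_add, hv, hw, map_add, map_add])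

theorem UnitaryRep.tensor_coeff (π σ : UnitaryRep Γ) (ξ η : π.space) (v w : σ.space) :
    (π.tensor σ).coeff ((ξ ⊗ₜ[ℂ] v : π.space ⊗[ℂ] σ.space) :
        UniformSpace.Completion (π.space ⊗[ℂ] σ.space))
      ((η ⊗ₜ[ℂ] w : π.space ⊗[ℂ] σ.space) : UniformSpace.Completion (π.space ⊗[ℂ] σ.space)) =
    π.coeff ξ η * σ.coeff v w := by
  funext x
  change inner ℂ ((η ⊗ₜ[ℂ] w : π.space ⊗[ℂ] σ.space) :
      UniformSpace.Completion (π.space ⊗[ℂ] σ.space))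
    (completionUnitary (TensorProduct.congrIsometry (π.hom x) (σ.hom x))
      ((ξ ⊗ₜ[ℂ] v : π.space ⊗[ℂ] σ.space) :
        UniformSpace.Completion (π.space ⊗[ℂ] σ.space))) = _
  rw [completionUnitary_coe, UniformSpace.Completion.inner_coe]
  simp [UnitaryRep.coeff]

/-- The orthogonal sum of two unitary representations. -/
def UnitaryRep.directSum (π σ : UnitaryRep Γ) : UnitaryRep Γ where
  space := WithLp 2 (π.space × σ.space)
  hom := MonoidHom.mk'
    (fun x =>
      { toLinearEquiv := (WithLp.linearEquiv 2 ℂ (π.space × σ.space)).trans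
          (((π.hom x).toLinearEquiv.prodCongr (σ.hom x).toLinearEquiv).trans
            (WithLp.linearEquiv 2 ℂ (π.space × σ.space)).symm)
        norm_map' := by
          intro v
          simp [WithLp.prod_norm_eq_of_L2] }) (by
    intro x y
    ext v
    simp)

theorem UnitaryRep.directSum_coeff (π σ : UnitaryRep Γ) (ξ η : π.space) (v w : σ.space) :
    (π.directSum σ).coeff (WithLp.toLp 2 (ξ, v) : WithLp 2 (π.space × σ.space))
      (WithLp.toLp 2 (η, w) : WithLp 2 (π.space × σ.space)) = π.coeff ξ η + σ.coeff v w := by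
  funext x
  exact WithLp.prod_inner_apply _ _

theorem fourierStieltjes_add {f g : Γ → ℂ} (hf : f ∈ fourierStieltjes Γ)
    (hg : g ∈ fourierStieltjes Γ) : f + g ∈ fourierStieltjes Γ := by
  obtain ⟨π, ξ, η, rfl⟩ := hf
  obtain ⟨σ, v, w, rfl⟩ := hg
  exact ⟨π.directSum σ, _, _, (π.directSum_coeff σ ξ η v w).symm⟩

theorem fourierStieltjes_mul {f g : Γ → ℂ} (hf : f ∈ fourierStieltjes Γ)
    (hg : g ∈ fourierStieltjes Γ) : f * g ∈ fourierStieltjes Γ := by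
  obtain ⟨π, ξ, η, rfl⟩ := hf
  obtain ⟨σ, v, w, rfl⟩ := hg
  exact ⟨π.tensor σ, _, _, (π.tensor_coeff σ ξ η v w).symm⟩

theorem fourierStieltjes_smul (t : ℂ) {f : Γ → ℂ} (hf : f ∈ fourierStieltjes Γ) :
    t • f ∈ fourierStieltjes Γ := by
  obtain ⟨π, ξ, η, rfl⟩ := hf
  exact ⟨π, t • ξ, η, by funext x; simp [UnitaryRep.coeff, inner_smul_right]⟩

theorem fourierStieltjes_zero : (0 : Γ → ℂ) ∈ fourierStieltjes Γ :=
  ⟨⟨PUnit, 1⟩, 0, 0, by funext x; simp [UnitaryRep.coeff]⟩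

theorem enorm_le_of_inner {H : Type u} [NormedAddCommGroup H] [InnerProductSpace ℂ H]
    (T : H →L[ℂ] H) {C : ℝ≥0∞} (hC : C < ∞)
    (h : ∀ v w : H, ‖⟪w, T v⟫_ℂ‖ₑ ≤ ‖v‖ₑ * ‖w‖ₑ * C) : ‖T‖ₑ ≤ C := by
  lift C to NNReal using hC.ne
  rw [enorm_le_coe, ← NNReal.coe_le_coe, coe_nnnorm]
  refine T.opNorm_le_bound C.2 fun v => ?_
  have h1 := h v (T v)
  simp only [enorm_eq_nnnorm] at h1
  have h2 : ‖⟪T v, T v⟫_ℂ‖ ≤ ‖v‖ * ‖T v‖ * C := by exact_mod_cast h1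
  rw [inner_self_eq_norm_sq_to_K, norm_pow, RCLike.norm_ofReal, abs_norm] at h2
  rcases (norm_nonneg (T v)).eq_or_lt with h0 | h0
  · rw [← h0]; positivity
  · exact le_of_mul_le_mul_right (by nlinarith) h0

theorem cstarNorm_mulFinsupp_coeff_le (π : UnitaryRep Γ) (ξ η : π.space) (b : Γ →₀ ℂ) :
    cstarNorm (mulFinsupp (π.coeff ξ η) b) ≤ ‖ξ‖ₑ * ‖η‖ₑ * cstarNorm b := by
  have hfin : ‖ξ‖ₑ * ‖η‖ₑ * cstarNorm b < ∞ :=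
    ENNReal.mul_lt_top (ENNReal.mul_lt_top enorm_lt_top enorm_lt_top) (cstarNorm_lt_top b)
  refine iSup_le fun σ => enorm_le_of_inner _ hfin fun v w => ?_
  rw [UnitaryRep.inner_eval, fsPair_mulFinsupp, mul_comm, ← UnitaryRep.tensor_coeff]
  have hf := fsNorm_lt_top (Γ := Γ) ⟨π.tensor σ, _, _, (rfl : (π.tensor σ).coeff
    ((ξ ⊗ₜ[ℂ] v : π.space ⊗[ℂ] σ.space) : UniformSpace.Completion (π.space ⊗[ℂ] σ.space))
    ((η ⊗ₜ[ℂ] w : π.space ⊗[ℂ] σ.space) : UniformSpace.Completion (π.space ⊗[ℂ] σ.space)) = _)⟩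
  refine (fsPair_le hf b).trans ?_
  refine (mul_le_mul_left (fsNorm_coeff_le _ _ _) _).trans ?_
  have h1 (a : π.space) (c : σ.space) :
      ‖((a ⊗ₜ[ℂ] c : π.space ⊗[ℂ] σ.space) : UniformSpace.Completion (π.space ⊗[ℂ] σ.space))‖ₑ =
        ‖a‖ₑ * ‖c‖ₑ := by
    rw [← ofReal_norm, UniformSpace.Completion.norm_coe, ofReal_norm, TensorProduct.enorm_tmul]
  refine le_of_eq ?_
  calc _ = (‖ξ‖ₑ * ‖v‖ₑ) * (‖η‖ₑ * ‖w‖ₑ) * cstarNorm b := by rw [← h1, ← h1]; rfl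
    _ = _ := by ring

theorem cstarNorm_mulFinsupp_le {f : Γ → ℂ} (hf : fsNorm f < ∞) (b : Γ →₀ ℂ) :
    cstarNorm (mulFinsupp f b) ≤ fsNorm f * cstarNorm b := by
  refine iSup_le fun σ => enorm_le_of_inner _ (ENNReal.mul_lt_top hf (cstarNorm_lt_top b))
    fun v w => ?_
  rw [UnitaryRep.inner_eval, fsPair_mulFinsupp, mul_comm, ← fsPair_mulFinsupp]
  calc _ ≤ fsNorm f * cstarNorm (mulFinsupp (σ.coeff v w) b) := fsPair_le hf _
    _ ≤ fsNorm f * (‖v‖ₑ * ‖w‖ₑ * cstarNorm b) := by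
      gcongr; exact cstarNorm_mulFinsupp_coeff_le σ v w b
    _ = _ := by ring

theorem fsNorm_mul_le {f g : Γ → ℂ} (hf : fsNorm f < ∞) (hg : fsNorm g < ∞) :
    fsNorm (f * g) ≤ fsNorm f * fsNorm g := by
  refine iSup₂_le fun b hb => ?_
  rw [← fsPair_mulFinsupp]
  calc _ ≤ fsNorm f * cstarNorm (mulFinsupp g b) := fsPair_le hf _
    _ ≤ fsNorm f * (fsNorm g * cstarNorm b) := by
      gcongr; exact cstarNorm_mulFinsupp_le hg b
    _ ≤ fsNorm f * (fsNorm g * 1) := by gcongr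
    _ = _ := by rw [mul_one]

end Lemmas

/-! ### The Fourier algebra -/

/-- The functions in the Fourier algebra `A(Γ)` of the discrete group `Γ`: the closure, in the
Banach algebra `B(Γ)`, of the functions with compact (that is, finite) support. -/
def fourierAlgebraFunctions (Γ : Type u) [Group Γ] : NonUnitalSubalgebra ℂ (Γ → ℂ) where
  carrier := {f | f ∈ fourierStieltjes Γ ∧
    ∀ ε : ℝ≥0∞, 0 < ε → ∃ g ∈ fourierStieltjes Γ, g.support.Finite ∧ fsNorm (f - g) < ε}
  zero_mem' := ⟨fourierStieltjes_zero, fun ε hε =>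
    ⟨0, fourierStieltjes_zero, by simp, by simpa [fsNorm_zero] using hε⟩⟩
  add_mem' := by
    rintro f f' ⟨hf, h⟩ ⟨hf', h'⟩
    refine ⟨fourierStieltjes_add hf hf', fun ε hε => ?_⟩
    obtain ⟨g, hg, hgs, hgε⟩ := h (ε / 2) (ENNReal.half_pos hε.ne')
    obtain ⟨g', hg', hgs', hgε'⟩ := h' (ε / 2) (ENNReal.half_pos hε.ne')
    refine ⟨g + g', fourierStieltjes_add hg hg',
      (hgs.union hgs').subset (Function.support_add _ _), ?_⟩
    rw [add_sub_add_comm]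
    calc _ ≤ fsNorm (f - g) + fsNorm (f' - g') := fsNorm_add_le _ _
      _ < ε / 2 + ε / 2 := ENNReal.add_lt_add hgε hgε'
      _ = ε := ENNReal.add_halves ε
  smul_mem' := by
    rintro t f ⟨hf, h⟩
    refine ⟨fourierStieltjes_smul t hf, fun ε hε => ?_⟩
    obtain ⟨δ, hδ, hδε⟩ : ∃ δ : ℝ≥0∞, 0 < δ ∧ ‖t‖ₑ * δ < ε := by
      obtain ⟨δ, hδ, h⟩ := ENNReal.exists_pos_mul_lt (enorm_ne_top (x := t)) hε.ne'
      exact ⟨δ, hδ, by rwa [mul_comm]⟩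
    obtain ⟨g, hg, hgs, hgδ⟩ := h δ hδ
    refine ⟨t • g, fourierStieltjes_smul t hg,
      hgs.subset (Function.support_const_smul_subset t g), ?_⟩
    rw [← smul_sub, fsNorm_smul]
    exact (mul_le_mul_right hgδ.le _).trans_lt hδε
  mul_mem' := by
    rintro f f' ⟨hf, h⟩ ⟨hf', -⟩
    refine ⟨fourierStieltjes_mul hf hf', fun ε hε => ?_⟩
    obtain ⟨δ, hδ, hδε⟩ : ∃ δ : ℝ≥0∞, 0 < δ ∧ fsNorm f' * δ < ε := by
      obtain ⟨δ, hδ, h⟩ := ENNReal.exists_pos_mul_lt (fsNorm_lt_top hf').ne hε.ne'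
      exact ⟨δ, hδ, by rwa [mul_comm]⟩
    obtain ⟨g, hg, hgs, hgδ⟩ := h δ hδ
    refine ⟨g * f', fourierStieltjes_mul hg hf',
      hgs.subset (Function.support_mul_subset_left g f'), ?_⟩
    rw [← sub_mul]
    refine (fsNorm_mul_le (hgδ.trans_le le_top) (fsNorm_lt_top hf')).trans_lt ?_
    rw [mul_comm]
    exact (mul_le_mul_right hgδ.le _).trans_lt hδε

/-- The Fourier algebra `A(Γ)` of the discrete group `Γ`, with pointwise operations and the
Fourier–Stieltjes norm. -/
def FourierAlgebra (Γ : Type u) [Group Γ] : Type u :=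
  fourierAlgebraFunctions Γ

namespace FourierAlgebra

variable {Γ : Type u} [Group Γ]

instance : NonUnitalCommRing (FourierAlgebra Γ) :=
  inferInstanceAs (NonUnitalCommRing (fourierAlgebraFunctions Γ))

instance : Module ℂ (FourierAlgebra Γ) :=
  inferInstanceAs (Module ℂ (fourierAlgebraFunctions Γ))

instance : IsScalarTower ℂ (FourierAlgebra Γ) (FourierAlgebra Γ) :=
  inferInstanceAs (IsScalarTower ℂ (fourierAlgebraFunctions Γ) (fourierAlgebraFunctions Γ))

instance : SMulCommClass ℂ (FourierAlgebra Γ) (FourierAlgebra Γ) :=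
  inferInstanceAs (SMulCommClass ℂ (fourierAlgebraFunctions Γ) (fourierAlgebraFunctions Γ))

/-- An element of the Fourier algebra as a function on the group. -/
def toFun (f : FourierAlgebra Γ) : Γ → ℂ :=
  f.1

theorem fsNorm_toFun_lt_top (f : FourierAlgebra Γ) : fsNorm f.toFun < ∞ :=
  fsNorm_lt_top f.2.1

instance : NormedAddCommGroup (FourierAlgebra Γ) :=
  AddGroupNorm.toNormedAddCommGroup
    { toFun := fun f => (fsNorm f.toFun).toReal
      map_zero' := by
        change (fsNorm (0 : Γ → ℂ)).toReal = 0
        simp [fsNorm_zero]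
      add_le' := fun f g => by
        rw [← ENNReal.toReal_add f.fsNorm_toFun_lt_top.ne g.fsNorm_toFun_lt_top.ne]
        exact ENNReal.toReal_mono
          (ENNReal.add_lt_top.2 ⟨f.fsNorm_toFun_lt_top, g.fsNorm_toFun_lt_top⟩).ne
          (fsNorm_add_le f.toFun g.toFun)
      neg' := fun f => congrArg ENNReal.toReal (fsNorm_neg f.toFun)
      eq_zero_of_map_eq_zero' := fun f hf => by
        have h0 : fsNorm f.toFun = 0 :=
          (ENNReal.toReal_eq_zero_iff _).1 hf |>.resolve_right f.fsNorm_toFun_lt_top.ne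
        refine Subtype.ext (funext fun x => ?_)
        have := enorm_apply_le_fsNorm f.toFun x
        rw [h0, nonpos_iff_eq_zero, enorm_eq_zero] at this
        exact this }

theorem norm_def (f : FourierAlgebra Γ) : ‖f‖ = (fsNorm f.toFun).toReal :=
  rfl

instance : NonUnitalNormedRing (FourierAlgebra Γ) :=
  { (inferInstance : NonUnitalCommRing (FourierAlgebra Γ)),
    (inferInstance : NormedAddCommGroup (FourierAlgebra Γ)) with
    norm_mul_le := fun f g => by
      change (fsNorm (f.toFun * g.toFun)).toReal ≤ _
      rw [norm_def, norm_def, ← ENNReal.toReal_mul]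
      exact ENNReal.toReal_mono
        (ENNReal.mul_lt_top f.fsNorm_toFun_lt_top g.fsNorm_toFun_lt_top).ne
        (fsNorm_mul_le f.fsNorm_toFun_lt_top g.fsNorm_toFun_lt_top) }

instance : NormedSpace ℂ (FourierAlgebra Γ) where
  norm_smul_le t f := by
    change (fsNorm (t • f.toFun)).toReal ≤ _
    rw [fsNorm_smul, ENNReal.toReal_mul, toReal_enorm, norm_def]

end FourierAlgebra

/-! ### The amenability constant of a Banach algebra -/

section Amenability

variable (A : Type u) [NonUnitalNormedRing A] [NormedSpace ℂ A] [IsScalarTower ℂ A A]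
  [SMulCommClass ℂ A A]

/-- The dual space `(A ⊗̂ A)*` of the projective tensor product, as the space of bounded bilinear
forms on `A` (an isometric identification, by the universal property of `⊗̂`): the functional
that corresponds to `F` is determined by `b ⊗ c ↦ F b c`. -/
abbrev ProjTensorDual := A →L[ℂ] A →L[ℂ] ℂ

/-- The bidual `(A ⊗̂ A)**`, with its dual norm. -/
abbrev ProjTensorBidual := ProjTensorDual A →L[ℂ] ℂ

variable {A}

/-- `F · a`, that is `b ⊗ c ↦ F (a • (b ⊗ c)) = F (ab) c`. -/
def ProjTensorDual.rightAct (F : ProjTensorDual A) (a : A) : ProjTensorDual A :=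
  F.comp (ContinuousLinearMap.mul ℂ A a)

/-- `a · F`, that is `b ⊗ c ↦ F ((b ⊗ c) • a) = F b (ca)`. -/
def ProjTensorDual.leftAct (a : A) (F : ProjTensorDual A) : ProjTensorDual A :=
  F.bilinearComp (ContinuousLinearMap.id ℂ A) ((ContinuousLinearMap.mul ℂ A).flip a)

/-- The adjoint of the product map `Δ : A ⊗̂ A → A`, `Δ (b ⊗ c) = bc`, applied to `φ ∈ A*`:
the functional `b ⊗ c ↦ φ (bc)`. -/
def mulDual (φ : A →L[ℂ] ℂ) : ProjTensorDual A :=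
  (ContinuousLinearMap.compL ℂ A A ℂ φ).comp (ContinuousLinearMap.mul ℂ A)

/-- `M ∈ (A ⊗̂ A)**` is a virtual diagonal for `A`: `a · M = M · a` and `a · Δ**(M) = a` (in
`A**`) for all `a ∈ A`. Here `⟨a · M, F⟩ = ⟨M, F · a⟩`, `⟨M · a, F⟩ = ⟨M, a · F⟩`, and
`⟨a · Δ**(M), φ⟩ = ⟨M, Δ*(φ · a)⟩` with `(φ · a)(b) = φ (ab)`. -/
def IsVirtualDiagonal (M : ProjTensorBidual A) : Prop :=
  (∀ (a : A) (F : ProjTensorDual A), M (F.rightAct a) = M (F.leftAct a)) ∧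
    ∀ (a : A) (φ : A →L[ℂ] ℂ), M (mulDual (φ.comp (ContinuousLinearMap.mul ℂ A a))) = φ a

variable (A) in
/-- The amenability constant of `A`: the infimum of the norms of the virtual diagonals for `A`
(`∞` if there are none, that is, if `A` is not amenable). -/
def amenabilityConstant : ℝ≥0∞ :=
  ⨅ (M : ProjTensorBidual A) (_ : IsVirtualDiagonal M), ‖M‖ₑ

end Amenability

end

/-! Write `S` for `|G|⁻¹ ∑ d_π³`. The proof closes the cycle `S ≤ AD(G) ≤ AM(A(G)) ≤ S`.

`S ≤ AD(G)`: pair the indicator of the anti-diagonal with one well-chosen element `b` of the group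
algebra of `G × G` (`flipElement`). Schur orthogonality produces matrix units `e i j` in each block
of the group algebra of `G`, and `b` is the sum over the blocks of `∑ e i j ⊗ e j i`. In every
unitary representation of `G × G` this is a self-adjoint partial isometry, so its C*-norm is at most
1, while its pairing with the indicator is `|G|⁻¹ ∑ d_π³`.

`AD(G) ≤ AM(A(G))`: the point masses are idempotents spanning `A(G)`, which forces every virtual
diagonal to be `∑ₓ δₓ ⊗ δₓ`. An element `b` of the unit ball of C*(G × G) defines a contractive
bilinear form `(a, c) ↦ ∑ b(x, y) a(x) c(y⁻¹)`, and a virtual diagonal sends this form to the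
pairing of `b` with the indicator of the anti-diagonal.

`AM(A(G)) ≤ S`: Fourier inversion at `x y⁻¹` rewrites the diagonal as `|G|⁻¹ ∑ d_π ∑ π_ij ⊗ (π_ji ∘
inv)`. For each `π` there are `d_π²` elementary tensors, each with factors of norm at most 1.

Only finite sets of classes and the supremum of their sums occur, so finiteness of the dual is never
needed. -/

noncomputable section

universe u

/-! ### Pullbacks and conjugates of unitary representations -/

/-- The inner product on the dual of a Hilbert space that comes from the Riesz representation. -/
abbrev dualInnerProductSpace (H : Type u) [NormedAddCommGroup H] [InnerProductSpace ℂ H]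
    [CompleteSpace H] : InnerProductSpace ℂ (StrongDual ℂ H) where
  inner f g := ⟪(InnerProductSpace.toDual ℂ H).symm g, (InnerProductSpace.toDual ℂ H).symm f⟫_ℂ
  norm_sq_eq_re_inner f := by
    rw [← LinearIsometryEquiv.norm_map (InnerProductSpace.toDual ℂ H).symm f]
    exact norm_sq_eq_re_inner _
  conj_inner_symm f g := inner_conj_symm _ _
  add_left f g h := by rw [map_add, inner_add_right]
  smul_left f g c := by rw [LinearIsometryEquiv.map_smulₛₗ, inner_smul_right]

namespace UnitaryRep

variable {Γ Γ' : Type u} [Group Γ] [Group Γ']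

/-- The pullback of a unitary representation along a group homomorphism. -/
def comap (π : UnitaryRep Γ') (φ : Γ →* Γ') : UnitaryRep Γ where
  space := π.space
  hom := π.hom.comp φ

/-- The conjugate of a unitary representation, realized on the dual space. -/
def conj (π : UnitaryRep Γ) : UnitaryRep Γ where
  space := StrongDual ℂ π.space
  innerProductSpace := dualInnerProductSpace π.space
  hom :=
    { toFun := fun x => (InnerProductSpace.toDual ℂ π.space).symm.trans
        ((π.hom x).trans (InnerProductSpace.toDual ℂ π.space))
      map_one' := by ext f v; simp
      map_mul' := fun x y => by ext f v; simp }

theorem conj_coeff (π : UnitaryRep Γ) (ξ η : π.space) (x : Γ) :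
    π.conj.coeff (InnerProductSpace.toDual ℂ π.space ξ) (InnerProductSpace.toDual ℂ π.space η) x =
      star (π.coeff ξ η x) := by
  change ⟪(InnerProductSpace.toDual ℂ π.space).symm (InnerProductSpace.toDual ℂ π.space
      (π.hom x ((InnerProductSpace.toDual ℂ π.space).symm
        (InnerProductSpace.toDual ℂ π.space ξ)))),
    (InnerProductSpace.toDual ℂ π.space).symm (InnerProductSpace.toDual ℂ π.space η)⟫_ℂ = _
  simp only [LinearIsometryEquiv.symm_apply_apply]
  exact (inner_conj_symm _ _).symm

theorem hom_mul_apply (π : UnitaryRep Γ) (x y : Γ) (v : π.space) :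
    π.hom (x * y) v = π.hom x (π.hom y v) := by
  rw [map_mul]
  rfl

theorem hom_one_apply (π : UnitaryRep Γ) (v : π.space) : π.hom 1 v = v := by
  rw [map_one]
  rfl

theorem inner_hom_left (π : UnitaryRep Γ) (x : Γ) (v w : π.space) :
    ⟪π.hom x v, w⟫_ℂ = ⟪v, π.hom x⁻¹ w⟫_ℂ := by
  rw [← LinearIsometryEquiv.inner_map_map (π.hom x) v, ← hom_mul_apply,
    mul_inv_cancel, hom_one_apply]

theorem coeff_inv (π : UnitaryRep Γ) (ξ η : π.space) (x : Γ) :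
    π.coeff ξ η x⁻¹ = star (π.coeff η ξ x) := by
  rw [coeff, ← inner_hom_left]
  exact (inner_conj_symm _ _).symm

end UnitaryRep

/-! ### Behaviour of the norms under homomorphisms and inversion -/

section Pairing

theorem fsPair_mapDomain {Γ Γ' : Type u} (φ : Γ → Γ') (f : Γ' → ℂ) (b : Γ →₀ ℂ) :
    fsPair f (b.mapDomain φ) = fsPair (f ∘ φ) b :=
  Finsupp.sum_mapDomain_index (by simp) fun _ _ _ => mul_add _ _ _

variable {Γ Γ' : Type u} [Group Γ] [Group Γ']

theorem UnitaryRep.enorm_coeff_fsPair_le (π : UnitaryRep Γ) (ξ η : π.space) (b : Γ →₀ ℂ) :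
    ‖fsPair (π.coeff ξ η) b‖ₑ ≤ ‖ξ‖ₑ * ‖η‖ₑ * cstarNorm b := by
  refine (fsPair_le (fsNorm_lt_top ⟨π, ξ, η, rfl⟩) b).trans ?_
  gcongr
  exact fsNorm_coeff_le π ξ η

theorem cstarNorm_mapDomain_le (φ : Γ →* Γ') (b : Γ →₀ ℂ) :
    cstarNorm (b.mapDomain φ) ≤ cstarNorm b := by
  refine iSup_le fun π => enorm_le_of_inner _ (cstarNorm_lt_top b) fun v w => ?_
  rw [UnitaryRep.inner_eval, fsPair_mapDomain]
  exact (π.comap φ).enorm_coeff_fsPair_le v w b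

/-- Inversion reverses products, so a representation cannot be pulled back along it. Instead,
`⟨π(x⁻¹)v, w⟩` is the complex conjugate of `⟨π(x)w, v⟩`, hence a coefficient of the conjugate
representation at vectors of the same norms. -/
theorem cstarNorm_mapDomain_inv_le (b : Γ →₀ ℂ) :
    cstarNorm (b.mapDomain Inv.inv) ≤ cstarNorm b := by
  refine iSup_le fun π => enorm_le_of_inner _ (cstarNorm_lt_top b) fun v w => ?_
  have h : π.coeff v w ∘ Inv.inv = π.conj.coeff (InnerProductSpace.toDual ℂ π.space w)
      (InnerProductSpace.toDual ℂ π.space v) := by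
    funext x
    rw [UnitaryRep.conj_coeff, Function.comp, UnitaryRep.coeff_inv]
  rw [UnitaryRep.inner_eval, fsPair_mapDomain, h, mul_comm ‖v‖ₑ]
  refine (π.conj.enorm_coeff_fsPair_le _ _ b).trans_eq ?_
  have h1 (v : π.space) : ‖(InnerProductSpace.toDual ℂ π.space) v‖ₑ = ‖v‖ₑ := by
    rw [← ofReal_norm, LinearIsometryEquiv.norm_map, ofReal_norm]
  rw [← h1 v, ← h1 w]
  rfl

theorem fsNorm_comp_le_of_cstarNorm_mapDomain_le {φ : Γ → Γ'}
    (hφ : ∀ b : Γ →₀ ℂ, cstarNorm (b.mapDomain φ) ≤ cstarNorm b) (f : Γ' → ℂ) :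
    fsNorm (f ∘ φ) ≤ fsNorm f := by
  refine iSup₂_le fun b hb => ?_
  rw [← fsPair_mapDomain]
  exact fsPair_le_of_cstarNorm_le_one f ((hφ b).trans hb)

theorem fsNorm_comp_le (φ : Γ →* Γ') (f : Γ' → ℂ) : fsNorm (f ∘ φ) ≤ fsNorm f :=
  fsNorm_comp_le_of_cstarNorm_mapDomain_le (cstarNorm_mapDomain_le φ) f

theorem fsNorm_comp_inv_le (f : Γ → ℂ) : fsNorm (f ∘ Inv.inv) ≤ fsNorm f :=
  fsNorm_comp_le_of_cstarNorm_mapDomain_le cstarNorm_mapDomain_inv_le f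

/-- Both factors are pullbacks along the projections, and the norm is submultiplicative. This is
what makes the bilinear form attached to an element of the unit ball of C*(G × G) contractive. -/
theorem fsNorm_mul_comp_fst_snd_le {f : Γ → ℂ} {g : Γ' → ℂ} (hf : fsNorm f < ∞)
    (hg : fsNorm g < ∞) :
    fsNorm (fun p : Γ × Γ' => f p.1 * g p.2) ≤ fsNorm f * fsNorm g :=
  have h1 := fsNorm_comp_le (MonoidHom.fst Γ Γ') f
  have h2 := fsNorm_comp_le (MonoidHom.snd Γ Γ') g
  (fsNorm_mul_le (h1.trans_lt hf) (h2.trans_lt hg)).trans (mul_le_mul' h1 h2)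

end Pairing

/-! ### Schur orthogonality -/

namespace UnitaryRep

section Schur

variable {Γ : Type u} [Group Γ] {π σ : UnitaryRep Γ}

/-- The orbit of a nonzero vector is finite, so its span is finite-dimensional, hence closed; it is
invariant and nonzero, hence everything. -/
theorem IsIrreducible.finiteDimensional [Finite Γ] (hπ : π.IsIrreducible) :
    FiniteDimensional ℂ π.space := by
  obtain ⟨hnt, h⟩ := hπ
  obtain ⟨v, hv⟩ := exists_ne (0 : π.space)
  set W := Submodule.span ℂ (Set.range fun x : Γ => π.hom x v) with hW
  have hfin : FiniteDimensional ℂ W := FiniteDimensional.span_of_finite ℂ (Set.finite_range _)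
  have hinv : ∀ x : Γ, ∀ w ∈ W, π.hom x w ∈ W := by
    intro x w hw
    induction hw using Submodule.span_induction with
    | mem w hw =>
      obtain ⟨y, rfl⟩ := hw
      exact Submodule.subset_span ⟨x * y, π.hom_mul_apply x y v⟩
    | zero => simp
    | add a b _ _ ha hb => rw [map_add]; exact W.add_mem ha hb
    | smul c a _ ha => rw [map_smul]; exact W.smul_mem c ha
  rcases h W W.closed_of_finiteDimensional hinv with h0 | h1
  · have hvW : v ∈ W := Submodule.subset_span ⟨1, π.hom_one_apply v⟩
    rw [h0, Submodule.mem_bot] at hvW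
    exact absurd hvW hv
  · rw [h1] at hfin
    exact ⟨Module.Finite.iff_fg.1 hfin⟩

/-- Schur's lemma: an eigenspace of an intertwiner is invariant and nonzero. -/
theorem IsIrreducible.exists_eq_smul [FiniteDimensional ℂ π.space] (hπ : π.IsIrreducible)
    (T : π.space →ₗ[ℂ] π.space) (hT : ∀ x v, T (π.hom x v) = π.hom x (T v)) :
    ∃ c : ℂ, ∀ v, T v = c • v := by
  obtain ⟨hnt, h⟩ := hπ
  obtain ⟨c, hc⟩ := Module.End.exists_eigenvalue T
  refine ⟨c, fun v => ?_⟩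
  rcases h (Module.End.eigenspace T c) (Submodule.closed_of_finiteDimensional _) (fun x v hv => by
      rw [Module.End.mem_eigenspace_iff] at hv ⊢
      rw [hT, hv, map_smul]) with h0 | h1
  · exact absurd h0 hc
  · exact Module.End.mem_eigenspace_iff.1 (h1 ▸ Submodule.mem_top)

/-- By Schur's lemma `T* T` is a scalar, so `T` is a multiple of an isometry. Its range is invariant
and nonzero, hence all of `σ.space`, and the rescaled `T` is a unitary equivalence. -/
theorem IsIrreducible.equivalent_of_ne_zero [FiniteDimensional ℂ π.space]
    [FiniteDimensional ℂ σ.space] (hπ : π.IsIrreducible) (hσ : σ.IsIrreducible)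
    (T : π.space →ₗ[ℂ] σ.space) (hT : ∀ x v, T (π.hom x v) = σ.hom x (T v)) (h0 : T ≠ 0) :
    π.Equivalent σ := by
  have hadj : ∀ x v, T.adjoint (σ.hom x v) = π.hom x (T.adjoint v) := by
    intro x v
    refine ext_inner_left ℂ fun w => ?_
    rw [LinearMap.adjoint_inner_right, ← inv_inv x, ← inner_hom_left, ← inner_hom_left,
      LinearMap.adjoint_inner_right, hT]
  obtain ⟨c, hc⟩ := hπ.exists_eq_smul (T.adjoint ∘ₗ T) fun x v => by
    rw [LinearMap.comp_apply, hT, hadj, LinearMap.comp_apply]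
  have hnorm (w : π.space) : ((‖T w‖ ^ 2 : ℝ) : ℂ) = c * ((‖w‖ ^ 2 : ℝ) : ℂ) := by
    have h1 : ⟪T w, T w⟫_ℂ = c * ⟪w, w⟫_ℂ := by
      rw [← LinearMap.adjoint_inner_right, ← LinearMap.comp_apply, hc, inner_smul_right]
    rw [inner_self_eq_norm_sq_to_K, inner_self_eq_norm_sq_to_K] at h1
    push_cast
    exact h1
  obtain ⟨v, hv⟩ : ∃ v, T v ≠ 0 := by
    by_contra! h
    exact h0 (LinearMap.ext h)
  have hv0 : 0 < ‖v‖ := norm_pos_iff.2 fun h => hv (by rw [h, map_zero])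
  -- The scaling factor of `T`, read off at one vector outside the kernel; the scalar `c` is its
  -- square.
  set r : ℝ := ‖T v‖ / ‖v‖ with hr
  have hrpos : 0 < r := div_pos (norm_pos_iff.2 hv) hv0
  have hcr : c = ((r ^ 2 : ℝ) : ℂ) := by
    have h2 := hnorm v
    have h3 : ((‖v‖ ^ 2 : ℝ) : ℂ) ≠ 0 := by exact_mod_cast (pow_pos hv0 2).ne'
    rw [hr, div_pow, Complex.ofReal_div, h2, mul_div_cancel_right₀ _ h3]
  have hTr (w : π.space) : ‖T w‖ = r * ‖w‖ := by
    have h2 := hnorm w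
    rw [hcr] at h2
    have h3 : ‖T w‖ ^ 2 = (r * ‖w‖) ^ 2 := by rw [mul_pow]; exact_mod_cast h2
    exact (sq_eq_sq₀ (norm_nonneg _) (by positivity)).1 h3
  have hUT (x : Γ) (w : π.space) : ((r : ℂ)⁻¹ • T) (π.hom x w) = σ.hom x (((r : ℂ)⁻¹ • T) w) := by
    rw [LinearMap.smul_apply, LinearMap.smul_apply, hT, map_smul]
  let U : π.space →ₗᵢ[ℂ] σ.space :=
    { toLinearMap := (r : ℂ)⁻¹ • T
      norm_map' := fun w => by
        rw [LinearMap.smul_apply, norm_smul, hTr, norm_inv, Complex.norm_real,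
          Real.norm_of_nonneg hrpos.le, inv_mul_cancel_left₀ hrpos.ne'] }
  have hsurj : Function.Surjective U := by
    rw [← LinearIsometry.coe_toLinearMap, ← LinearMap.range_eq_top]
    refine (hσ.2 _ (Submodule.closed_of_finiteDimensional _) ?_).resolve_left fun h => ?_
    · rintro x _ ⟨w, rfl⟩
      exact ⟨π.hom x w, hUT x w⟩
    · rw [LinearMap.range_eq_bot] at h
      have h2 : ‖U v‖ = 0 := by
        rw [← LinearIsometry.coe_toLinearMap, h, LinearMap.zero_apply, norm_zero]
      rw [U.norm_map] at h2
      exact hv0.ne' h2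
  exact ⟨LinearIsometryEquiv.ofSurjective U hsurj, hUT⟩

end Schur

section Orthogonality

variable {G : Type u} [Group G] [Fintype G]

/-- The average `∑ₓ π(x⁻¹) A σ(x)`, where `A = ⟨η, ·⟩ ξ` has rank one. -/
def averageRankOne (π σ : UnitaryRep G) (ξ : π.space) (η : σ.space) : σ.space →ₗ[ℂ] π.space :=
  ∑ x : G, (π.hom x⁻¹).toLinearEquiv.toLinearMap ∘ₗ
    (InnerProductSpace.rankOne ℂ ξ η).toLinearMap ∘ₗ (σ.hom x).toLinearEquiv.toLinearMap

variable {π σ : UnitaryRep G}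

theorem averageRankOne_apply (ξ : π.space) (η v : σ.space) :
    averageRankOne π σ ξ η v = ∑ x : G, σ.coeff v η x • π.hom x⁻¹ ξ := by
  simp [averageRankOne, coeff, LinearMap.sum_apply]

theorem averageRankOne_hom (ξ : π.space) (η v : σ.space) (y : G) :
    averageRankOne π σ ξ η (σ.hom y v) = π.hom y (averageRankOne π σ ξ η v) := by
  rw [averageRankOne_apply, averageRankOne_apply, map_sum]
  refine Fintype.sum_equiv (Equiv.mulRight y) _ _ fun x => ?_
  rw [map_smul, ← hom_mul_apply, Equiv.coe_mulRight, mul_inv_rev, mul_inv_cancel_left, coeff, coeff,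
    hom_mul_apply]

theorem inner_averageRankOne (ξ η : π.space) (ξ' η' : σ.space) :
    ⟪η, averageRankOne π σ ξ η' ξ'⟫_ℂ = ∑ x : G, π.coeff ξ η x⁻¹ * σ.coeff ξ' η' x := by
  rw [averageRankOne_apply, inner_sum]
  exact Finset.sum_congr rfl fun x _ => by rw [inner_smul_right, mul_comm]; rfl

theorem sum_coeff_mul_coeff_of_not_equivalent (hπ : π.IsIrreducible) (hσ : σ.IsIrreducible)
    (h : ¬ σ.Equivalent π) (ξ η : π.space) (ξ' η' : σ.space) :
    ∑ x : G, π.coeff ξ η x⁻¹ * σ.coeff ξ' η' x = 0 := by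
  have := hπ.finiteDimensional
  have := hσ.finiteDimensional
  rw [← inner_averageRankOne]
  have h0 : averageRankOne π σ ξ η' = 0 := by
    by_contra h0
    exact h (hσ.equivalent_of_ne_zero hπ _ (fun x v => averageRankOne_hom ξ η' v x) h0)
  rw [h0, LinearMap.zero_apply, inner_zero_right]

/-- The average of a rank-one operator is an intertwiner, hence a scalar, and the scalar is found by
computing the trace in two ways. -/
theorem finrank_mul_sum_coeff_mul_coeff (hπ : π.IsIrreducible) (ξ η ξ' η' : π.space) :
    (Module.finrank ℂ π.space : ℂ) * ∑ x : G, π.coeff ξ η x⁻¹ * π.coeff ξ' η' x =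
      Fintype.card G * (⟪η, ξ'⟫_ℂ * ⟪η', ξ⟫_ℂ) := by
  have := hπ.finiteDimensional
  obtain ⟨c, hc⟩ := hπ.exists_eq_smul (averageRankOne π π ξ η')
    fun x v => averageRankOne_hom ξ η' v x
  let e := stdOrthonormalBasis ℂ π.space
  have h1 : ∑ i, ⟪e i, averageRankOne π π ξ η' (e i)⟫_ℂ = Module.finrank ℂ π.space * c := by
    simp [hc, inner_smul_right]
  -- Each of the `|G|` unitary conjugates of `⟨η', ·⟩ ξ` has trace `⟪η', ξ⟫`.
  have h2 : ∑ i, ⟪e i, averageRankOne π π ξ η' (e i)⟫_ℂ = Fintype.card G * ⟪η', ξ⟫_ℂ := by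
    simp_rw [inner_averageRankOne]
    rw [Finset.sum_comm, ← nsmul_eq_mul, ← Finset.card_univ, ← Finset.sum_const]
    refine Finset.sum_congr rfl fun x _ => ?_
    have h3 (i) : π.coeff ξ (e i) x⁻¹ * π.coeff (e i) η' x =
        ⟪π.hom x⁻¹ η', e i⟫_ℂ * ⟪e i, π.hom x⁻¹ ξ⟫_ℂ := by
      rw [mul_comm, inner_hom_left, inv_inv]
      rfl
    simp_rw [h3]
    rw [e.sum_inner_mul_inner, LinearIsometryEquiv.inner_map_map]
  rw [← inner_averageRankOne, hc, inner_smul_right]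
  linear_combination ⟪η, ξ'⟫_ℂ * (h2 - h1)

end Orthogonality

end UnitaryRep

/-! ### Completeness of the matrix coefficients -/

namespace UnitaryRep

section Subrepresentation

variable {Γ : Type u} [Group Γ]

/-- The restriction of a unitary representation to an invariant subspace. -/
def subrep (π : UnitaryRep Γ) (W : Submodule ℂ π.space) [CompleteSpace W]
    (hW : ∀ x : Γ, ∀ v ∈ W, π.hom x v ∈ W) : UnitaryRep Γ where
  space := W
  hom :=
    { toFun := fun x =>
        { toFun := fun v => ⟨π.hom x v, hW x v v.2⟩
          invFun := fun v => ⟨π.hom x⁻¹ v, hW x⁻¹ v v.2⟩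
          map_add' := fun v w => Subtype.ext (map_add (π.hom x) v.1 w.1)
          map_smul' := fun c v => Subtype.ext (map_smul (π.hom x) c v.1)
          left_inv := fun v => Subtype.ext (by
            change π.hom x⁻¹ (π.hom x v) = v
            rw [← hom_mul_apply, inv_mul_cancel, hom_one_apply])
          right_inv := fun v => Subtype.ext (by
            change π.hom x (π.hom x⁻¹ v) = v
            rw [← hom_mul_apply, mul_inv_cancel, hom_one_apply])
          norm_map' := fun v => (π.hom x).norm_map v.1 }
      map_one' := LinearIsometryEquiv.ext fun v => Subtype.ext (π.hom_one_apply v.1)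
      map_mul' := fun x y => LinearIsometryEquiv.ext fun v =>
        Subtype.ext (π.hom_mul_apply x y v.1) }

/-- In finite dimension there is a minimal nonzero invariant subspace of `W`, and minimality is
irreducibility. -/
theorem exists_irreducible_subrep (π : UnitaryRep Γ) [FiniteDimensional ℂ π.space]
    (W : Submodule ℂ π.space) (hW : ∀ x : Γ, ∀ v ∈ W, π.hom x v ∈ W) (h0 : W ≠ ⊥) :
    ∃ (W' : Submodule ℂ π.space) (hW' : ∀ x : Γ, ∀ v ∈ W', π.hom x v ∈ W'),
      W' ≤ W ∧ (π.subrep W' hW').IsIrreducible := by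
  obtain ⟨W', ⟨hle, hne, hinv⟩, hmin⟩ := WellFounded.has_min
    (wellFounded_lt (α := Submodule ℂ π.space))
    {W' | W' ≤ W ∧ W' ≠ ⊥ ∧ ∀ x : Γ, ∀ v ∈ W', π.hom x v ∈ W'} ⟨W, le_rfl, h0, hW⟩
  refine ⟨W', hinv, hle, (Submodule.nontrivial_iff_ne_bot).2 hne, fun V _ hV => ?_⟩
  by_cases hV0 : V = ⊥
  · exact Or.inl hV0
  right
  have hle' : Submodule.map W'.subtype V ≤ W' := Submodule.map_subtype_le W' V
  have hmem : Submodule.map W'.subtype V ∈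
      {W' | W' ≤ W ∧ W' ≠ ⊥ ∧ ∀ x : Γ, ∀ v ∈ W', π.hom x v ∈ W'} := by
    refine ⟨hle'.trans hle, fun h => hV0 ?_, ?_⟩
    · exact Submodule.map_injective_of_injective (Submodule.subtype_injective W')
        (h.trans (Submodule.map_bot _).symm)
    · rintro x _ ⟨v, hv, rfl⟩
      exact ⟨_, hV x v hv, rfl⟩
  have heq : Submodule.map W'.subtype V = W' :=
    hle'.eq_of_not_lt (hmin _ hmem)
  refine (Submodule.eq_top_iff' (p := V)).2 fun (v : W') => ?_
  have hv : (v : π.space) ∈ Submodule.map W'.subtype V := by rw [heq]; exact v.2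
  obtain ⟨w, hw, hwv⟩ := hv
  have : w = v := Subtype.ext hwv
  exact this ▸ hw

end Subrepresentation

section Regular

variable {G : Type u} [Group G]

variable (G) in
/-- The span of the coefficient functions of the irreducible representations. -/
def irreducibleCoeffSpan : Submodule ℂ (G → ℂ) :=
  Submodule.span ℂ {f | ∃ π : UnitaryRep G, π.IsIrreducible ∧ ∃ ξ η, f = π.coeff ξ η}

theorem irreducibleCoeffSpan_comp_mul_right {f : G → ℂ} (hf : f ∈ irreducibleCoeffSpan G) (x : G) :
    (fun y => f (y * x)) ∈ irreducibleCoeffSpan G := by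
  induction hf using Submodule.span_induction with
  | mem f hf =>
    obtain ⟨π, hπ, ξ, η, rfl⟩ := hf
    refine Submodule.subset_span ⟨π, hπ, π.hom x ξ, η, ?_⟩
    funext y
    rw [coeff, coeff, hom_mul_apply]
  | zero => exact Submodule.zero_mem _
  | add f g _ _ hf hg => exact Submodule.add_mem _ hf hg
  | smul c f _ hf => exact Submodule.smul_mem _ c hf

variable [Fintype G]

variable (G) in
/-- The right regular representation of a finite group. -/
def rightRegular : UnitaryRep G where
  space := EuclideanSpace ℂ G
  hom :=
    { toFun := fun x => LinearIsometryEquiv.piLpCongrLeft 2 ℂ ℂ (Equiv.mulRight x⁻¹)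
      map_one' := LinearIsometryEquiv.ext fun f => WithLp.ofLp_injective 2 <| funext fun y => by
        change f.ofLp ((Equiv.mulRight 1⁻¹).symm y) = f.ofLp y
        simp
      map_mul' := fun x y => LinearIsometryEquiv.ext fun f =>
        WithLp.ofLp_injective 2 <| funext fun z => by
          change f.ofLp ((Equiv.mulRight (x * y)⁻¹).symm z) =
            f.ofLp ((Equiv.mulRight y⁻¹).symm ((Equiv.mulRight x⁻¹).symm z))
          simp [mul_assoc] }

variable (G) in
/-- The vectors of the right regular representation as functions. -/
def rightRegularEquiv : (rightRegular G).space ≃ₗ[ℂ] (G → ℂ) :=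
  WithLp.linearEquiv 2 ℂ (G → ℂ)

theorem rightRegularEquiv_hom (x : G) (f : (rightRegular G).space) (y : G) :
    rightRegularEquiv G ((rightRegular G).hom x f) y = rightRegularEquiv G f (y * x) := by
  change f.ofLp ((Equiv.mulRight x⁻¹).symm y) = f.ofLp (y * x)
  simp

open Classical in
theorem exists_inner_eq_rightRegularEquiv :
    ∃ δ : (rightRegular G).space, ∀ f, ⟪δ, f⟫_ℂ = rightRegularEquiv G f 1 := by
  refine ⟨(EuclideanSpace.single 1 1 : EuclideanSpace ℂ G), fun f => ?_⟩
  refine (EuclideanSpace.inner_single_left (1 : G) (1 : ℂ) (f : EuclideanSpace ℂ G)).trans ?_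
  rw [map_one, one_mul]
  rfl

instance : FiniteDimensional ℂ (rightRegular G).space :=
  inferInstanceAs (FiniteDimensional ℂ (EuclideanSpace ℂ G))

/-- The span is invariant under right translation, and so is its orthogonal complement in the
regular representation. If the complement were nonzero it would contain an irreducible `W`; but
functions in `W` are themselves coefficients of `W`, so they would be orthogonal to themselves. -/
theorem irreducibleCoeffSpan_eq_top : irreducibleCoeffSpan G = ⊤ := by
  set C : Submodule ℂ (rightRegular G).space :=
    (irreducibleCoeffSpan G).comap (rightRegularEquiv G).toLinearMap with hC
  have hCinv (x : G) (f) (hf : f ∈ C) : (rightRegular G).hom x f ∈ C := by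
    have h : rightRegularEquiv G ((rightRegular G).hom x f) =
        fun y => rightRegularEquiv G f (y * x) :=
      funext fun y => rightRegularEquiv_hom x f y
    rw [hC, Submodule.mem_comap, LinearEquiv.coe_toLinearMap, h]
    exact irreducibleCoeffSpan_comp_mul_right hf x
  have hbot : Cᗮ = ⊥ := by
    by_contra h0
    obtain ⟨W, hW, hWC, hirr⟩ := (rightRegular G).exists_irreducible_subrep Cᗮ (fun x v hv =>
      (Submodule.mem_orthogonal' C _).2 fun w hw => by
        rw [inner_hom_left]
        exact (Submodule.mem_orthogonal' C v).1 hv _ (hCinv x⁻¹ w hw)) h0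
    obtain ⟨f, hf, hf0⟩ := W.exists_mem_ne_zero_of_ne_bot
      ((Submodule.nontrivial_iff_ne_bot).1 hirr.1)
    obtain ⟨δ, hδ⟩ := exists_inner_eq_rightRegularEquiv (G := G)
    -- `f x` is the value at 1 of the translate of `f` by `x`, that is, its inner product with `δ`.
    -- The translate stays in `W`, so `δ` may be replaced by its projection to `W`.
    have hfC : f ∈ C := by
      refine Submodule.subset_span ⟨_, hirr, (⟨f, hf⟩ : W),
        W.orthogonalProjectionOnto δ, ?_⟩
      funext x
      have h1 : ⟪δ, (rightRegular G).hom x f⟫_ℂ = rightRegularEquiv G f x := by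
        rw [hδ, rightRegularEquiv_hom, one_mul]
      refine h1.symm.trans ?_
      exact (Submodule.inner_orthogonalProjectionOnto_eq_of_mem_right
        (⟨_, hW x f hf⟩ : W) δ).symm
    exact hf0 (inner_self_eq_zero.1 ((Submodule.mem_orthogonal C f).1 (hWC hf) f hfC))
  rw [Submodule.orthogonal_eq_bot_iff] at hbot
  refine (Submodule.eq_top_iff').2 fun f => ?_
  have h : (rightRegularEquiv G).symm f ∈ C := hbot ▸ Submodule.mem_top
  rwa [hC, Submodule.mem_comap, LinearEquiv.coe_toLinearMap, LinearEquiv.apply_symm_apply] at h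

end Regular

theorem Equivalent.exists_coeff_eq {Γ : Type u} [Group Γ] {π σ : UnitaryRep Γ}
    (h : π.Equivalent σ) (ξ η : π.space) : ∃ ξ' η' : σ.space, π.coeff ξ η = σ.coeff ξ' η' := by
  obtain ⟨U, hU⟩ := h
  refine ⟨U ξ, U η, funext fun x => ?_⟩
  rw [coeff, coeff, ← hU, LinearIsometryEquiv.inner_map_map]

end UnitaryRep

/-! ### Matrix coefficients of the unitary dual and Fourier inversion -/

namespace UnitaryDual

variable {G : Type u} [Group G]

/-- A representative of a class in the unitary dual. -/
def rep (q : UnitaryDual G) : UnitaryRep G :=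
  (Quotient.out q).1

theorem rep_irreducible (q : UnitaryDual G) : q.rep.IsIrreducible :=
  (Quotient.out q).2

theorem finrank_rep (q : UnitaryDual G) : Module.finrank ℂ q.rep.space = q.dim := by
  conv_rhs => rw [← Quotient.out_eq q]
  rfl

theorem rep_not_equivalent {p q : UnitaryDual G} (h : p ≠ q) : ¬ p.rep.Equivalent q.rep :=
  fun h' => h (Quotient.out_equiv_out.1 h')

instance [Finite G] (q : UnitaryDual G) : FiniteDimensional ℂ q.rep.space :=
  q.rep_irreducible.finiteDimensional

theorem dim_ne_zero [Finite G] (q : UnitaryDual G) : (q.dim : ℂ) ≠ 0 := by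
  have := q.rep_irreducible.1
  rw [← finrank_rep]
  exact Nat.cast_ne_zero.2 Module.finrank_pos.ne'

/-- An orthonormal basis of the space of a representative. -/
def onb [Finite G] (q : UnitaryDual G) : OrthonormalBasis (Fin q.dim) ℂ q.rep.space :=
  (stdOrthonormalBasis ℂ q.rep.space).reindex (finCongr q.finrank_rep)

/-- The matrix coefficients of a representative in an orthonormal basis. -/
def matrixCoeff [Finite G] (q : UnitaryDual G) (i j : Fin q.dim) : G → ℂ :=
  q.rep.coeff (q.onb j) (q.onb i)

theorem matrixCoeff_inv [Finite G] (q : UnitaryDual G) (i j : Fin q.dim) (x : G) :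
    q.matrixCoeff i j x⁻¹ = star (q.matrixCoeff j i x) :=
  q.rep.coeff_inv _ _ x

theorem matrixCoeff_mul [Finite G] (q : UnitaryDual G) (i j : Fin q.dim) (x y : G) :
    q.matrixCoeff i j (x * y) = ∑ k, q.matrixCoeff i k x * q.matrixCoeff k j y := by
  have h (k) : q.matrixCoeff i k x * q.matrixCoeff k j y =
      ⟪q.rep.hom x⁻¹ (q.onb i), q.onb k⟫_ℂ * ⟪q.onb k, q.rep.hom y (q.onb j)⟫_ℂ := by
    rw [UnitaryRep.inner_hom_left, inv_inv]
    rfl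
  simp_rw [h]
  rw [q.onb.sum_inner_mul_inner, UnitaryRep.inner_hom_left, inv_inv, ← UnitaryRep.hom_mul_apply]
  rfl

variable [Fintype G]

theorem sum_matrixCoeff_of_ne {p q : UnitaryDual G} (h : p ≠ q) (i j : Fin p.dim)
    (k l : Fin q.dim) : ∑ x : G, p.matrixCoeff i j x⁻¹ * q.matrixCoeff k l x = 0 :=
  UnitaryRep.sum_coeff_mul_coeff_of_not_equivalent p.rep_irreducible q.rep_irreducible
    (rep_not_equivalent h.symm) _ _ _ _

theorem sum_matrixCoeff_self (q : UnitaryDual G) (i j k l : Fin q.dim) :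
    ∑ x : G, q.matrixCoeff i j x⁻¹ * q.matrixCoeff k l x =
      if i = l ∧ k = j then (Fintype.card G / q.dim : ℂ) else 0 := by
  have h := UnitaryRep.finrank_mul_sum_coeff_mul_coeff q.rep_irreducible
    (q.onb j) (q.onb i) (q.onb l) (q.onb k)
  rw [finrank_rep, q.onb.inner_eq_ite, q.onb.inner_eq_ite, ite_zero_mul_ite_zero, one_mul] at h
  refine mul_left_cancel₀ q.dim_ne_zero (h.trans ?_)
  split_ifs
  · rw [mul_one, mul_div_cancel₀ _ q.dim_ne_zero]
  · simp

theorem sum_coeff_mul_matrixCoeff_of_ne {p q : UnitaryDual G} (h : p ≠ q) (ξ η : p.rep.space)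
    (x : G) (i : Fin q.dim) :
    ∑ y : G, p.rep.coeff ξ η y * q.matrixCoeff i i (y⁻¹ * x) = 0 := by
  rw [← UnitaryRep.sum_coeff_mul_coeff_of_not_equivalent q.rep_irreducible p.rep_irreducible
    (rep_not_equivalent h) (q.rep.hom x (q.onb i)) (q.onb i) ξ η]
  refine Finset.sum_congr rfl fun y _ => ?_
  rw [matrixCoeff, UnitaryRep.coeff, UnitaryRep.coeff, UnitaryRep.coeff, UnitaryRep.hom_mul_apply,
    mul_comm]

/-- The sum over `i` is convolution with the character of `q`. With the factor `d_q / |G|` it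
reproduces the coefficients of `q`, and by `sum_coeff_mul_matrixCoeff_of_ne` it kills those of the
other classes. -/
theorem sum_coeff_mul_matrixCoeff_self (q : UnitaryDual G) (ξ η : q.rep.space) (x : G) :
    q.dim * ∑ i, ∑ y : G, q.rep.coeff ξ η y * q.matrixCoeff i i (y⁻¹ * x) =
      Fintype.card G * q.rep.coeff ξ η x := by
  have h1 (i) : (q.dim : ℂ) * ∑ y : G, q.rep.coeff ξ η y * q.matrixCoeff i i (y⁻¹ * x) =
      Fintype.card G * (⟪q.rep.hom x⁻¹ η, q.onb i⟫_ℂ * ⟪q.onb i, ξ⟫_ℂ) := by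
    have h := UnitaryRep.finrank_mul_sum_coeff_mul_coeff q.rep_irreducible
      (q.rep.hom x (q.onb i)) (q.onb i) ξ η
    rw [finrank_rep] at h
    rw [UnitaryRep.inner_hom_left, inv_inv, mul_comm ⟪η, _⟫_ℂ, ← h]
    congr 1
    refine Finset.sum_congr rfl fun y _ => ?_
    rw [matrixCoeff, UnitaryRep.coeff, UnitaryRep.coeff, UnitaryRep.coeff,
      UnitaryRep.hom_mul_apply, mul_comm]
  rw [Finset.mul_sum, Finset.sum_congr rfl fun i _ => h1 i, ← Finset.mul_sum,
    q.onb.sum_inner_mul_inner, UnitaryRep.inner_hom_left, inv_inv]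
  rfl

/-- By completeness it suffices to treat a coefficient of a single class, where one term of the sum
survives. Allowing every `T` above `T₀` lets the sets of two summands be merged. -/
theorem exists_finset_card_mul_eq_sum (f : G → ℂ) :
    ∃ T₀ : Finset (UnitaryDual G), ∀ T, T₀ ⊆ T → ∀ x, Fintype.card G * f x =
      ∑ q ∈ T, q.dim * ∑ i, ∑ y : G, f y * q.matrixCoeff i i (y⁻¹ * x) := by
  classical
  have hf : f ∈ UnitaryRep.irreducibleCoeffSpan G := by
    rw [UnitaryRep.irreducibleCoeffSpan_eq_top]
    exact Submodule.mem_top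
  induction hf using Submodule.span_induction with
  | mem f hf =>
    obtain ⟨π, hπ, ξ, η, rfl⟩ := hf
    set q : UnitaryDual G := Quotient.mk _ ⟨π, hπ⟩ with hq
    have hequiv : π.Equivalent q.rep :=
      UnitaryRep.Equivalent.symm (Quotient.mk_out (s := unitaryDualSetoid G) ⟨π, hπ⟩)
    obtain ⟨ξ', η', h⟩ := hequiv.exists_coeff_eq ξ η
    rw [h]
    refine ⟨{q}, fun T hT x => ?_⟩
    rw [Finset.sum_eq_single_of_mem q (hT (Finset.mem_singleton_self q)),
      sum_coeff_mul_matrixCoeff_self]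
    intro p _ hp
    simp_rw [sum_coeff_mul_matrixCoeff_of_ne hp.symm]
    simp
  | zero => exact ⟨∅, fun T _ x => by simp⟩
  | add f g _ _ hf hg =>
    obtain ⟨T₁, h₁⟩ := hf
    obtain ⟨T₂, h₂⟩ := hg
    refine ⟨T₁ ∪ T₂, fun T hT x => ?_⟩
    rw [Pi.add_apply, mul_add, h₁ T (Finset.union_subset_left hT),
      h₂ T (Finset.union_subset_right hT)]
    simp only [Pi.add_apply, add_mul, Finset.sum_add_distrib, mul_add]
  | smul c f _ hf =>
    obtain ⟨T₁, h₁⟩ := hf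
    refine ⟨T₁, fun T hT x => ?_⟩
    rw [Pi.smul_apply, smul_eq_mul, mul_left_comm, h₁ T hT]
    simp only [Pi.smul_apply, smul_eq_mul, mul_assoc, Finset.mul_sum, mul_left_comm c]

-- Fourier inversion for the point mass at 1, whose convolution with a character is the character.
variable (G) in
open Classical in
theorem exists_finset_delta_eq_sum :
    ∃ T : Finset (UnitaryDual G), ∀ x : G, (if x = 1 then (1 : ℂ) else 0) =
      (Fintype.card G : ℂ)⁻¹ * ∑ q ∈ T, q.dim * ∑ i, q.matrixCoeff i i x := by
  obtain ⟨T, hT⟩ := exists_finset_card_mul_eq_sum (fun x : G => if x = 1 then (1 : ℂ) else 0)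
  refine ⟨T, fun x => ?_⟩
  have h := hT T subset_rfl x
  simp only [ite_mul, one_mul, zero_mul, Finset.sum_ite_eq', Finset.mem_univ, if_true,
    inv_one] at h
  rw [← h, inv_mul_cancel_left₀ (Nat.cast_ne_zero.2 Fintype.card_ne_zero)]

end UnitaryDual

/-! ### Matrix units and the lower bound for the anti-diagonal constant -/

namespace UnitaryRep

section Operators

variable {Γ : Type u} [Group Γ] (θ : UnitaryRep Γ)

/-- The unitary operator `θ(x)` as a continuous linear map. -/
def op (x : Γ) : θ.space →L[ℂ] θ.space :=
  (θ.hom x).toContinuousLinearEquiv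

theorem op_apply (x : Γ) (v : θ.space) : θ.op x v = θ.hom x v :=
  rfl

theorem op_mul (x y : Γ) : θ.op (x * y) = θ.op x * θ.op y :=
  ContinuousLinearMap.ext fun v => θ.hom_mul_apply x y v

theorem star_op (x : Γ) : star (θ.op x) = θ.op x⁻¹ := by
  rw [ContinuousLinearMap.star_eq_adjoint, eq_comm, ContinuousLinearMap.eq_adjoint_iff]
  intro v w
  rw [op_apply, op_apply, inner_hom_left, inv_inv]

end Operators

section MatrixUnits

variable {G Γ : Type u} [Group G] [Fintype G] [Group Γ] (θ : UnitaryRep Γ) (φ : G →* Γ)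

/-- The matrix units that a homomorphism `φ : G →* Γ` and a unitary representation of `Γ` induce on
its space from the coefficients of an irreducible representation of `G`. -/
def matrixUnit (q : UnitaryDual G) (i j : Fin q.dim) : θ.space →L[ℂ] θ.space :=
  (q.dim / Fintype.card G : ℂ) • ∑ x : G, q.matrixCoeff j i x⁻¹ • θ.op (φ x)

theorem star_matrixUnit (q : UnitaryDual G) (i j : Fin q.dim) :
    star (θ.matrixUnit φ q i j) = θ.matrixUnit φ q j i := by
  rw [matrixUnit, matrixUnit, star_smul, star_sum]
  congr 1
  · simp
  · refine Fintype.sum_equiv (Equiv.inv G) _ _ fun x => ?_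
    rw [star_smul, star_op, Equiv.inv_apply, map_inv, inv_inv, UnitaryDual.matrixCoeff_inv, star_star]

/-- With `z = x y`, the coefficient at `y⁻¹ = z⁻¹ x` is expanded by `matrixCoeff_mul`; this isolates
an inner sum over `x` to which Schur orthogonality applies. -/
theorem matrixUnit_mul (p q : UnitaryDual G) (i j : Fin p.dim) (k l : Fin q.dim) :
    θ.matrixUnit φ p i j * θ.matrixUnit φ q k l =
      (p.dim / Fintype.card G * (q.dim / Fintype.card G) : ℂ) • ∑ z : G,
        (∑ r, q.matrixCoeff l r z⁻¹ *
          ∑ x : G, p.matrixCoeff j i x⁻¹ * q.matrixCoeff r k x) • θ.op (φ z) := by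
  rw [matrixUnit, matrixUnit, smul_mul_smul_comm, Finset.sum_mul]
  congr 1
  have h (x : G) : (p.matrixCoeff j i x⁻¹ • θ.op (φ x)) * ∑ y : G, q.matrixCoeff l k y⁻¹ • θ.op (φ y) =
      ∑ z : G, (p.matrixCoeff j i x⁻¹ * q.matrixCoeff l k (z⁻¹ * x)) • θ.op (φ z) := by
    rw [Finset.mul_sum]
    refine Fintype.sum_equiv (Equiv.mulLeft x) _ _ fun y => ?_
    rw [smul_mul_smul_comm, ← op_mul, ← map_mul, Equiv.coe_mulLeft, mul_inv_rev, inv_mul_cancel_right]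
  simp_rw [h]
  rw [Finset.sum_comm]
  refine Finset.sum_congr rfl fun z _ => ?_
  rw [← Finset.sum_smul]
  congr 1
  simp_rw [UnitaryDual.matrixCoeff_mul, Finset.mul_sum]
  rw [Finset.sum_comm]
  exact Finset.sum_congr rfl fun r _ => Finset.sum_congr rfl fun x _ => mul_left_comm _ _ _

theorem matrixUnit_mul_of_ne {p q : UnitaryDual G} (h : p ≠ q) (i j : Fin p.dim)
    (k l : Fin q.dim) : θ.matrixUnit φ p i j * θ.matrixUnit φ q k l = 0 := by
  simp [matrixUnit_mul, UnitaryDual.sum_matrixCoeff_of_ne h]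

theorem matrixUnit_mul_self (q : UnitaryDual G) (i j k l : Fin q.dim) :
    θ.matrixUnit φ q i j * θ.matrixUnit φ q k l = if j = k then θ.matrixUnit φ q i l else 0 := by
  have hn : (Fintype.card G : ℂ) ≠ 0 := Nat.cast_ne_zero.2 Fintype.card_ne_zero
  have hd := q.dim_ne_zero
  rw [matrixUnit_mul]
  simp only [UnitaryDual.sum_matrixCoeff_self]
  split_ifs with hjk
  · simp only [hjk, true_and, mul_ite, mul_zero, Finset.sum_ite_eq', Finset.mem_univ, if_true]
    rw [matrixUnit, Finset.smul_sum, Finset.smul_sum]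
    refine Finset.sum_congr rfl fun x _ => ?_
    rw [smul_smul, smul_smul]
    congr 1
    field_simp
  · simp [hjk]

theorem commute_matrixUnit {φ ψ : G →* Γ} (h : ∀ x y, Commute (φ x) (ψ y)) (p q : UnitaryDual G)
    (i j : Fin p.dim) (k l : Fin q.dim) :
    Commute (θ.matrixUnit φ p i j) (θ.matrixUnit ψ q k l) := by
  rw [commute_iff_eq, matrixUnit, matrixUnit, smul_mul_smul_comm, smul_mul_smul_comm,
    Finset.sum_mul_sum, Finset.sum_mul_sum, Finset.sum_comm, mul_comm (p.dim / _ : ℂ)]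
  congr 1
  refine Finset.sum_congr rfl fun y _ => Finset.sum_congr rfl fun x _ => ?_
  rw [smul_mul_smul_comm, smul_mul_smul_comm, ← op_mul, ← op_mul, (h x y).eq, mul_comm]

end MatrixUnits

end UnitaryRep

/-- A self-adjoint partial isometry is a contraction. -/
theorem norm_le_one_of_mul_self_mul_self {A : Type*} [NormedRing A] [StarRing A] [CStarRing A]
    {a : A} (hs : star a = a) (h : a * a * a = a) : ‖a‖ ≤ 1 := by
  have h1 : ‖a * a‖ = ‖a‖ * ‖a‖ := by
    simpa [hs] using CStarRing.norm_star_mul_self (x := a)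
  have h2 : ‖(a * a) * (a * a)‖ = ‖a * a‖ * ‖a * a‖ := by
    simpa [hs] using CStarRing.norm_star_mul_self (x := a * a)
  -- Since `a⁴ = a²`, the C*-identity for `a` and for `a²` gives `‖a‖² = ‖a‖⁴`.
  rw [← mul_assoc, h, h1] at h2
  by_contra! h3
  have h4 : 1 < ‖a‖ * ‖a‖ := one_lt_mul_of_lt_of_le h3 h3.le
  exact (lt_mul_of_one_lt_left (zero_lt_one.trans h4) h4).ne h2

/-- The flip built from two commuting families of matrix units is a partial isometry. -/
theorem sum_matrixUnits_mul_self_mul_self {A ι : Type*} [Ring A] [Fintype ι] [DecidableEq ι]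
    (e f : ι → ι → A) (he : ∀ i j k l, e i j * e k l = if j = k then e i l else 0)
    (hf : ∀ i j k l, f i j * f k l = if j = k then f i l else 0)
    (hc : ∀ i j k l, Commute (e i j) (f k l)) :
    (∑ i, ∑ j, e i j * f j i) * (∑ i, ∑ j, e i j * f j i) * (∑ i, ∑ j, e i j * f j i) =
      ∑ i, ∑ j, e i j * f j i := by
  have hmul (i j k l i' j' k' l') : (e i j * f k l) * (e i' j' * f k' l') =
      (if j = i' then e i j' else 0) * (if l = k' then f k l' else 0) := by
    rw [(hc i' j' k l).symm.mul_mul_mul_comm, he, hf]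
  -- The square of the flip is the product of `∑ e i i` and `∑ f j j`, which acts as an identity on
  -- the flip.
  have h2 : (∑ i, ∑ j, e i j * f j i) * (∑ i, ∑ j, e i j * f j i) =
      ∑ i, ∑ j, e i i * f j j := by
    simp only [Finset.sum_mul, Finset.mul_sum, hmul]
    simpa using Finset.sum_comm
  rw [h2]
  simp only [Finset.sum_mul, Finset.mul_sum, hmul]
  simp

/-! ### The flip element and its pairing with the anti-diagonal -/

namespace UnitaryDual

variable {G : Type u} [Group G]

theorem indicator_adiag_apply [DecidableEq G] (x y : G) :
    (adiag G).indicator (1 : G × G → ℂ) (x, y) = if x⁻¹ = y then 1 else 0 := by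
  have h : (x, y) ∈ adiag G ↔ x⁻¹ = y := by
    constructor
    · rintro ⟨z, hz⟩
      rw [Prod.mk.injEq] at hz
      rw [← hz.1, hz.2]
    · rintro rfl
      exact ⟨x, rfl⟩
  classical
  rw [Set.indicator_apply]
  simp only [h, Pi.one_apply]

variable [Fintype G]

/-- The element of the group algebra of `G × G` that acts on `π ⊗ π` as the flip for `π` in `T`,
and as zero on the other irreducible representations. -/
def flipElement (T : Finset (UnitaryDual G)) : G × G →₀ ℂ :=
  Finsupp.equivFunOnFinite.symm fun p => ∑ q ∈ T, ∑ i, ∑ j,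
    (q.dim / Fintype.card G : ℂ) ^ 2 * (q.matrixCoeff j i p.1⁻¹ * q.matrixCoeff i j p.2⁻¹)

/-- Since `ρ(x, y) = ρ(x, 1) ρ(1, y)`, the double sum over `G × G` factors, and each matrix unit
takes one of the two factors `d_q / |G|`. -/
theorem eval_flipElement (T : Finset (UnitaryDual G)) (ρ : UnitaryRep (G × G)) :
    ρ.eval (flipElement T) = ∑ q ∈ T, ∑ i, ∑ j,
      ρ.matrixUnit (MonoidHom.inl G G) q i j *
        ρ.matrixUnit (MonoidHom.inr G G) q j i := by
  have h1 : ρ.eval (flipElement T) = ∑ p : G × G, flipElement T p • ρ.op p :=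
    Finsupp.sum_fintype _ _ fun p => zero_smul _ _
  have h2 (x y : G) : ρ.op (x, y) =
      ρ.op (MonoidHom.inl G G x) * ρ.op (MonoidHom.inr G G y) := by
    rw [← UnitaryRep.op_mul]
    simp
  rw [h1, Fintype.sum_prod_type]
  simp only [flipElement, Finsupp.equivFunOnFinite_symm_apply_apply, Finset.sum_smul]
  simp_rw [Finset.sum_comm (s := Finset.univ) (t := T)]
  refine Finset.sum_congr rfl fun q _ => ?_
  simp_rw [Finset.sum_comm (s := (Finset.univ : Finset G)) (t := (Finset.univ : Finset (Fin _)))]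
  refine Finset.sum_congr rfl fun i _ => Finset.sum_congr rfl fun j _ => ?_
  rw [UnitaryRep.matrixUnit, UnitaryRep.matrixUnit]
  rw [smul_mul_smul_comm, Finset.sum_mul_sum, Finset.smul_sum]
  refine Finset.sum_congr rfl fun x _ => ?_
  rw [Finset.smul_sum]
  refine Finset.sum_congr rfl fun y _ => ?_
  rw [smul_mul_smul_comm, h2, smul_smul, sq]

/-- In any representation the blocks `B q` are self-adjoint, satisfy `B³ = B` and annihilate one
another, so their sum is again a self-adjoint partial isometry. -/
theorem cstarNorm_flipElement_le (T : Finset (UnitaryDual G)) : cstarNorm (flipElement T) ≤ 1 := by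
  refine iSup_le fun ρ => ?_
  rw [← ofReal_norm, ENNReal.ofReal_le_one]
  let e := ρ.matrixUnit (MonoidHom.inl G G)
  let f := ρ.matrixUnit (MonoidHom.inr G G)
  have hes (q : UnitaryDual G) (i j) : star (e q i j) = e q j i := ρ.star_matrixUnit _ q i j
  have hfs (q : UnitaryDual G) (i j) : star (f q i j) = f q j i := ρ.star_matrixUnit _ q i j
  have hc (p q : UnitaryDual G) (i j k l) : Commute (e p i j) (f q k l) :=
    ρ.commute_matrixUnit (fun x y => by simp [commute_iff_eq]) p q i j k l
  let B (q : UnitaryDual G) : ρ.space →L[ℂ] ρ.space := ∑ i, ∑ j, e q i j * f q j i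
  have hB : ρ.eval (flipElement T) = ∑ q ∈ T, B q := eval_flipElement T ρ
  have hBs (q) : star (B q) = B q := by
    simp only [B, star_sum, star_mul, hes, hfs]
    rw [Finset.sum_comm]
    exact Finset.sum_congr rfl fun i _ => Finset.sum_congr rfl fun j _ => (hc q q i j j i).symm.eq
  have hBB {p q} (h : p ≠ q) : B p * B q = 0 := by
    simp only [B, Finset.sum_mul, Finset.mul_sum]
    refine Finset.sum_eq_zero fun i _ => Finset.sum_eq_zero fun j _ => Finset.sum_eq_zero fun k _ =>
      Finset.sum_eq_zero fun l _ => ?_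
    rw [(hc _ _ _ _ _ _).symm.mul_mul_mul_comm, ρ.matrixUnit_mul_of_ne _ h, zero_mul]
  have hB3 (q) : B q * B q * B q = B q :=
    sum_matrixUnits_mul_self_mul_self (e q) (f q)
      (ρ.matrixUnit_mul_self _ q) (ρ.matrixUnit_mul_self _ q) (hc q q)
  rw [hB]
  refine norm_le_one_of_mul_self_mul_self (by simp [hBs]) ?_
  have h2 : (∑ q ∈ T, B q) * ∑ q ∈ T, B q = ∑ q ∈ T, B q * B q := by
    rw [Finset.sum_mul_sum]
    refine Finset.sum_congr rfl fun p hp => ?_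
    exact Finset.sum_eq_single_of_mem p hp fun q _ hq => hBB hq.symm
  rw [h2, Finset.sum_mul_sum]
  refine Finset.sum_congr rfl fun p hp => ?_
  rw [Finset.sum_eq_single_of_mem p hp fun q _ hq => by rw [mul_assoc, hBB hq.symm, mul_zero], hB3]

theorem fsPair_indicator_adiag (b : G × G →₀ ℂ) :
    fsPair ((adiag G).indicator 1) b = ∑ x : G, b (x, x⁻¹) := by
  classical
  rw [fsPair, Finsupp.sum_fintype _ _ (by simp), Fintype.sum_prod_type]
  simp [indicator_adiag_apply]

/-- On the anti-diagonal, orthogonality turns each of the `d²` pairs `(i, j)` into `(d / |G|)² · |G|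
/ d`, for a total of `d³ / |G|`. -/
theorem fsPair_flipElement (T : Finset (UnitaryDual G)) :
    fsPair ((adiag G).indicator 1) (flipElement T) =
      (Fintype.card G : ℂ)⁻¹ * ∑ q ∈ T, (q.dim : ℂ) ^ 3 := by
  have hn : (Fintype.card G : ℂ) ≠ 0 := Nat.cast_ne_zero.2 Fintype.card_ne_zero
  rw [fsPair_indicator_adiag]
  simp only [flipElement, Finsupp.equivFunOnFinite_symm_apply_apply, inv_inv]
  rw [Finset.sum_comm, Finset.mul_sum]
  refine Finset.sum_congr rfl fun q _ => ?_
  have hd := q.dim_ne_zero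
  simp_rw [Finset.sum_comm (s := (Finset.univ : Finset G)) (t := (Finset.univ : Finset (Fin _))),
    ← Finset.mul_sum, sum_matrixCoeff_self]
  simp
  field_simp

theorem card_inv_mul_sum_dim_le_fsNorm (T : Finset (UnitaryDual G)) :
    (Fintype.card G : ℝ≥0∞)⁻¹ * ∑ q ∈ T, (q.dim : ℝ≥0∞) ^ 3 ≤
      fsNorm ((adiag G).indicator (1 : G × G → ℂ)) := by
  refine le_trans (le_of_eq ?_) (fsPair_le_of_cstarNorm_le_one _ (cstarNorm_flipElement_le T))
  have h : (Fintype.card G : ℂ)⁻¹ * ∑ q ∈ T, (q.dim : ℂ) ^ 3 =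
      (((Fintype.card G : ℝ)⁻¹ * ∑ q ∈ T, (q.dim : ℝ) ^ 3 : ℝ) : ℂ) := by
    push_cast
    rfl
  rw [fsPair_flipElement, h, ← ofReal_norm, Complex.norm_real, Real.norm_of_nonneg (by positivity),
    ENNReal.ofReal_mul (by positivity), ENNReal.ofReal_inv_of_pos (by positivity),
    ENNReal.ofReal_natCast, ENNReal.ofReal_sum_of_nonneg fun _ _ => by positivity]
  simp [ENNReal.ofReal_pow]

end UnitaryDual

/-! ### The Fourier algebra of a finite group -/

theorem mem_fourierStieltjes_of_finite {G : Type u} [Group G] [Finite G] (f : G → ℂ) :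
    f ∈ fourierStieltjes G := by
  have := Fintype.ofFinite G
  have hf : f ∈ UnitaryRep.irreducibleCoeffSpan G := by
    rw [UnitaryRep.irreducibleCoeffSpan_eq_top]
    exact Submodule.mem_top
  induction hf using Submodule.span_induction with
  | mem f hf =>
    obtain ⟨π, -, ξ, η, rfl⟩ := hf
    exact ⟨π, ξ, η, rfl⟩
  | zero => exact fourierStieltjes_zero
  | add f g _ _ hf hg => exact fourierStieltjes_add hf hg
  | smul c f _ hf => exact fourierStieltjes_smul c hf

namespace FourierAlgebra

variable {G : Type u} [Group G]

/-- Evaluation at a point. -/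
def evalAt (x : G) : FourierAlgebra G →L[ℂ] ℂ :=
  LinearMap.mkContinuous
    { toFun := fun a => a.toFun x
      map_add' := fun _ _ => rfl
      map_smul' := fun _ _ => rfl } 1 fun a => by
    have h := ENNReal.toReal_mono a.fsNorm_toFun_lt_top.ne (enorm_apply_le_fsNorm a.toFun x)
    rwa [toReal_enorm, ← norm_def, ← one_mul ‖a‖] at h

theorem evalAt_apply (x : G) (a : FourierAlgebra G) : evalAt x a = a.toFun x :=
  rfl

/-- The bilinear form on the Fourier algebra induced by an element of the group algebra of
`G × G`. -/
def bilinOfFinsupp (b : G × G →₀ ℂ) (hb : cstarNorm b ≤ 1) : ProjTensorDual (FourierAlgebra G) :=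
  LinearMap.mkContinuous₂
    (LinearMap.mk₂ ℂ (fun a c : FourierAlgebra G =>
        -- The inversion in the second variable exchanges the diagonal and the anti-diagonal.
        fsPair (fun p : G × G => a.toFun p.1 * (c.toFun ∘ Inv.inv) p.2) b)
      (fun a a' c => by
        simp only [fsPair, Finsupp.sum]
        rw [← Finset.sum_add_distrib]
        refine Finset.sum_congr rfl fun p _ => ?_
        change (a.toFun p.1 + a'.toFun p.1) * _ * _ = _
        ring)
      (fun t a c => by
        simp only [fsPair, Finsupp.sum]
        rw [Finset.smul_sum]
        refine Finset.sum_congr rfl fun p _ => ?_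
        change t * a.toFun p.1 * _ * _ = t * _
        ring)
      (fun a c c' => by
        simp only [fsPair, Finsupp.sum]
        rw [← Finset.sum_add_distrib]
        refine Finset.sum_congr rfl fun p _ => ?_
        change _ * (c.toFun p.2⁻¹ + c'.toFun p.2⁻¹) * _ = a.toFun p.1 * c.toFun p.2⁻¹ * _ +
          a.toFun p.1 * c'.toFun p.2⁻¹ * _
        ring)
      (fun t a c => by
        simp only [fsPair, Finsupp.sum]
        rw [Finset.smul_sum]
        refine Finset.sum_congr rfl fun p _ => ?_
        change _ * (t * c.toFun p.2⁻¹) * _ = t * (a.toFun p.1 * c.toFun p.2⁻¹ * _)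
        ring)) 1 fun a c => by
    have hc := fsNorm_comp_inv_le c.toFun
    have h := (fsPair_le_of_cstarNorm_le_one _ hb).trans
      ((fsNorm_mul_comp_fst_snd_le a.fsNorm_toFun_lt_top (hc.trans_lt c.fsNorm_toFun_lt_top)).trans
        (mul_le_mul_right hc _))
    have h' := ENNReal.toReal_mono
      (ENNReal.mul_lt_top a.fsNorm_toFun_lt_top c.fsNorm_toFun_lt_top).ne h
    rw [toReal_enorm, ENNReal.toReal_mul] at h'
    rw [one_mul]
    exact h'

theorem norm_bilinOfFinsupp_le (b : G × G →₀ ℂ) (hb : cstarNorm b ≤ 1) :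
    ‖bilinOfFinsupp b hb‖ ≤ 1 :=
  LinearMap.mkContinuous₂_norm_le _ zero_le_one _

section Finite

variable [Finite G]

variable (G) in
/-- A function on a finite group as an element of the Fourier algebra. -/
def ofFun : (G → ℂ) →ₗ[ℂ] FourierAlgebra G where
  toFun f := ⟨f, mem_fourierStieltjes_of_finite f, fun ε hε =>
    ⟨f, mem_fourierStieltjes_of_finite f, Set.toFinite _, by rwa [sub_self, fsNorm_zero]⟩⟩
  map_add' _ _ := rfl
  map_smul' _ _ := rfl

theorem ofFun_toFun (a : FourierAlgebra G) : ofFun G a.toFun = a :=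
  rfl

theorem norm_ofFun_le_one {f : G → ℂ} (h : fsNorm f ≤ 1) : ‖ofFun G f‖ ≤ 1 :=
  ENNReal.toReal_le_of_le_ofReal zero_le_one (h.trans_eq ENNReal.ofReal_one.symm)

open Classical in
/-- The indicator function of a point. -/
def delta (x : G) : FourierAlgebra G :=
  ofFun G (Pi.single x 1)

theorem mul_delta (a : FourierAlgebra G) (x : G) : a * delta x = a.toFun x • delta x := by
  classical
  refine Subtype.ext (funext fun y => ?_)
  change a.toFun y * (Pi.single x 1 : G → ℂ) y = a.toFun x * (Pi.single x 1 : G → ℂ) y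
  by_cases h : y = x
  · rw [h]
  · simp [h]

theorem delta_mul (a : FourierAlgebra G) (x : G) : delta x * a = a.toFun x • delta x := by
  rw [← mul_delta]
  exact mul_comm (delta x) a

theorem toFun_delta_self (x : G) : (delta x).toFun x = 1 := by
  classical
  exact Pi.single_eq_same (M := fun _ : G => ℂ) x 1

end Finite

/-! ### Virtual diagonals of the Fourier algebra of a finite group -/

variable [Fintype G]

theorem eq_sum_delta (a : FourierAlgebra G) : a = ∑ x, a.toFun x • delta x := by
  classical
  conv_lhs => rw [← ofFun_toFun a, pi_eq_sum_univ' a.toFun]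
  rw [map_sum]
  refine Finset.sum_congr rfl fun x _ => ?_
  rw [map_smul]
  congr 2

theorem eq_sum_delta_delta (F : ProjTensorDual (FourierAlgebra G)) (a b : FourierAlgebra G) :
    F a b = ∑ x, ∑ y, a.toFun x * b.toFun y * F (delta x) (delta y) := by
  conv_lhs => rw [eq_sum_delta a, eq_sum_delta b]
  simp only [map_sum, map_smul, sum_apply, smul_apply,
    smul_eq_mul, mul_assoc, Finset.mul_sum]
  rw [Finset.sum_comm]
  exact Finset.sum_congr rfl fun x _ => Finset.sum_congr rfl fun y _ => mul_left_comm _ _ _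

/-- A virtual diagonal for the Fourier algebra of a finite group is `∑ₓ δₓ ⊗ δₓ`. -/
theorem isVirtualDiagonal_apply_eq_sum {M : ProjTensorBidual (FourierAlgebra G)}
    (hM : IsVirtualDiagonal M) (F : ProjTensorDual (FourierAlgebra G)) :
    M F = ∑ x, F (delta x) (delta x) := by
  -- The point masses are idempotents with sum 1. Acting twice on the same side leaves one factor to
  -- be moved to the other side.
  have h1 : F = ∑ x, (F.rightAct (delta x)).rightAct (delta x) := by
    ext a b
    conv_lhs => rw [eq_sum_delta a]
    simp only [map_sum, sum_apply]
    refine Finset.sum_congr rfl fun x _ => ?_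
    change _ = F (delta x * (delta x * a)) b
    rw [← mul_assoc, mul_delta (delta x), toFun_delta_self, one_smul, delta_mul]
  -- Cut down by `δₓ` on both sides, `F` depends only on `a x * b x`. It is therefore a form that
  -- factors through the product, where the second axiom gives the value of `M`.
  have h2 (x : G) : (F.rightAct (delta x)).leftAct (delta x) =
      F (delta x) (delta x) • mulDual ((evalAt x).comp (ContinuousLinearMap.mul ℂ _ (delta x))) := by
    ext a b
    change F (delta x * a) (b * delta x) = F (delta x) (delta x) * (delta x * (a * b)).toFun x
    rw [delta_mul, mul_delta, delta_mul]
    change _ = F (delta x) (delta x) * ((a.toFun x * b.toFun x) * (delta x).toFun x)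
    rw [toFun_delta_self, map_smul, map_smul, smul_apply, smul_eq_mul,
      smul_eq_mul]
    ring
  conv_lhs => rw [h1]
  rw [map_sum]
  refine Finset.sum_congr rfl fun x _ => ?_
  rw [hM.1, h2, map_smul, hM.2, evalAt_apply, toFun_delta_self, smul_eq_mul, mul_one]

variable (G) in
/-- The virtual diagonal `∑ₓ δₓ ⊗ δₓ`. -/
def diagonal : ProjTensorBidual (FourierAlgebra G) :=
  ∑ x : G, (ContinuousLinearMap.apply ℂ ℂ (delta x)).comp
    (ContinuousLinearMap.apply ℂ (FourierAlgebra G →L[ℂ] ℂ) (delta x))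

theorem diagonal_apply (F : ProjTensorDual (FourierAlgebra G)) :
    diagonal G F = ∑ x, F (delta x) (delta x) := by
  simp [diagonal, sum_apply]

variable (G) in
theorem isVirtualDiagonal_diagonal : IsVirtualDiagonal (diagonal G) := by
  refine ⟨fun a F => ?_, fun a φ => ?_⟩
  · rw [diagonal_apply, diagonal_apply]
    refine Finset.sum_congr rfl fun x _ => ?_
    change F (a * delta x) (delta x) = F (delta x) (delta x * a)
    rw [mul_delta, delta_mul, map_smul, map_smul]
    rfl
  · rw [diagonal_apply]
    conv_rhs => rw [eq_sum_delta a, map_sum]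
    refine Finset.sum_congr rfl fun x _ => ?_
    change φ (a * (delta x * delta x)) = _
    rw [mul_delta (delta x), toFun_delta_self, one_smul, mul_delta]

-- The bound comes from expanding the diagonal in matrix coefficients instead of point masses.
variable (G) in
theorem enorm_diagonal_le : ‖diagonal G‖ₑ ≤
    (Fintype.card G : ℝ≥0∞)⁻¹ * ∑' q : UnitaryDual G, (q.dim : ℝ≥0∞) ^ 3 := by
  classical
  obtain ⟨T, hT⟩ := UnitaryDual.exists_finset_delta_eq_sum G
  have hbound : ‖diagonal G‖ ≤ (Fintype.card G : ℝ)⁻¹ * ∑ q ∈ T, (q.dim : ℝ) ^ 3 := by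
    refine ContinuousLinearMap.opNorm_le_bound _ (by positivity) fun F => ?_
    have h1 : diagonal G F = (Fintype.card G : ℂ)⁻¹ * ∑ q ∈ T, q.dim * ∑ i, ∑ j,
        F (ofFun G (q.matrixCoeff i j)) (ofFun G (q.matrixCoeff j i ∘ Inv.inv)) := by
      -- Fourier inversion at `x * y⁻¹`, with the character split by multiplicativity of the
      -- matrices.
      have h2 (x y : G) : (if x = y then (1 : ℂ) else 0) = (Fintype.card G : ℂ)⁻¹ *
          ∑ q ∈ T, q.dim * ∑ i, ∑ j, q.matrixCoeff i j x * q.matrixCoeff j i y⁻¹ := by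
        have h3 := hT (x * y⁻¹)
        simp only [mul_inv_eq_one, UnitaryDual.matrixCoeff_mul] at h3
        exact h3
      have h4 : diagonal G F =
          ∑ x : G, ∑ y : G, (if x = y then (1 : ℂ) else 0) * F (delta x) (delta y) := by
        simp [diagonal_apply]
      rw [h4]
      simp_rw [h2, mul_assoc, ← Finset.mul_sum]
      congr 1
      simp_rw [Finset.sum_mul, Finset.sum_comm (s := (Finset.univ : Finset G)) (t := T)]
      refine Finset.sum_congr rfl fun q _ => ?_
      simp_rw [mul_assoc, ← Finset.mul_sum]
      congr 1
      simp_rw [Finset.sum_mul,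
        Finset.sum_comm (s := (Finset.univ : Finset G)) (t := (Finset.univ : Finset (Fin _)))]
      refine Finset.sum_congr rfl fun i _ => Finset.sum_congr rfl fun j _ => ?_
      rw [eq_sum_delta_delta F]
      rfl
    -- Coefficients at unit vectors have norm at most 1, and inversion does not increase the norm.
    have h5 (q : UnitaryDual G) (i j : Fin q.dim) :
        ‖F (ofFun G (q.matrixCoeff i j)) (ofFun G (q.matrixCoeff j i ∘ Inv.inv))‖ ≤ ‖F‖ := by
      have h6 (i j : Fin q.dim) : fsNorm (q.matrixCoeff i j) ≤ 1 := by
        refine (fsNorm_coeff_le _ _ _).trans_eq ?_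
        rw [← ofReal_norm, ← ofReal_norm, q.onb.norm_eq_one, q.onb.norm_eq_one]
        simp
      refine (F.le_opNorm₂ _ _).trans ?_
      refine mul_le_of_le_one_right (by positivity) (norm_ofFun_le_one ?_) |>.trans ?_
      · exact (fsNorm_comp_inv_le _).trans (h6 j i)
      · exact mul_le_of_le_one_right (by positivity) (norm_ofFun_le_one (h6 i j))
    rw [h1, norm_mul, norm_inv, Complex.norm_natCast, mul_assoc, Finset.sum_mul]
    gcongr
    refine (norm_sum_le _ _).trans (Finset.sum_le_sum fun q _ => ?_)
    rw [norm_mul, Complex.norm_natCast]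
    -- There are `d²` terms, and the weight `d` from Fourier inversion makes this `d³`.
    have h7 : ‖∑ i, ∑ j, F (ofFun G (q.matrixCoeff i j)) (ofFun G (q.matrixCoeff j i ∘ Inv.inv))‖ ≤
        ∑ _i : Fin q.dim, ∑ _j : Fin q.dim, ‖F‖ :=
      (norm_sum_le _ _).trans (Finset.sum_le_sum fun i _ =>
        (norm_sum_le _ _).trans (Finset.sum_le_sum fun j _ => h5 q i j))
    refine (mul_le_mul_of_nonneg_left h7 (Nat.cast_nonneg _)).trans_eq ?_
    simp
    ring
  rw [← ofReal_norm]
  refine (ENNReal.ofReal_le_ofReal hbound).trans ?_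
  rw [ENNReal.ofReal_mul (by positivity), ENNReal.ofReal_inv_of_pos (by positivity),
    ENNReal.ofReal_natCast, ENNReal.ofReal_sum_of_nonneg fun _ _ => by positivity]
  gcongr
  refine le_of_eq_of_le ?_ (ENNReal.sum_le_tsum T)
  simp [ENNReal.ofReal_pow]

theorem sum_bilinOfFinsupp_delta (b : G × G →₀ ℂ) (hb : cstarNorm b ≤ 1) :
    ∑ x, bilinOfFinsupp b hb (delta x) (delta x) = fsPair ((adiag G).indicator 1) b := by
  classical
  rw [UnitaryDual.fsPair_indicator_adiag]
  refine Finset.sum_congr rfl fun x _ => ?_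
  change fsPair (fun p : G × G => (Pi.single x 1 : G → ℂ) p.1 * (Pi.single x 1 : G → ℂ) p.2⁻¹) b = _
  rw [fsPair, Finsupp.sum_fintype _ _ (by simp), Fintype.sum_prod_type]
  simp [Pi.single_apply, inv_eq_iff_eq_inv]

/-- Each `b` in the unit ball gives a form of norm at most 1 on which `M` takes the value of the
pairing of `b` with the indicator. -/
theorem fsNorm_indicator_adiag_le {M : ProjTensorBidual (FourierAlgebra G)}
    (hM : IsVirtualDiagonal M) : fsNorm ((adiag G).indicator (1 : G × G → ℂ)) ≤ ‖M‖ₑ := by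
  refine iSup₂_le fun b hb => ?_
  rw [← sum_bilinOfFinsupp_delta b hb, ← isVirtualDiagonal_apply_eq_sum hM, ← ofReal_norm, ← ofReal_norm]
  refine ENNReal.ofReal_le_ofReal ((M.le_opNorm _).trans ?_)
  exact mul_le_of_le_one_right (norm_nonneg M) (norm_bilinOfFinsupp_le b hb)

end FourierAlgebra

end

theorem theorem1p1 {G : Type*} [Group G] [Finite G] :
    antidiagonalConstant G =
        (Nat.card G : ℝ≥0∞)⁻¹ * ∑' π : UnitaryDual G, (π.dim : ℝ≥0∞) ^ 3 ∧
      (Nat.card G : ℝ≥0∞)⁻¹ * ∑' π : UnitaryDual G, (π.dim : ℝ≥0∞) ^ 3 =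
        amenabilityConstant (FourierAlgebra G) := by
  have := Fintype.ofFinite G
  have hAD : antidiagonalConstant G = fsNorm ((adiag G).indicator (1 : G × G → ℂ)) :=
    if_pos (mem_fourierStieltjes_of_finite _)
  have h1 : (Nat.card G : ℝ≥0∞)⁻¹ * ∑' π : UnitaryDual G, (π.dim : ℝ≥0∞) ^ 3 ≤
      antidiagonalConstant G := by
    -- The infinite sum is the supremum of its finite partial sums, each bounded by means of its own
    -- flip element.
    rw [hAD, Nat.card_eq_fintype_card, ENNReal.tsum_eq_iSup_sum, ENNReal.mul_iSup]
    exact iSup_le UnitaryDual.card_inv_mul_sum_dim_le_fsNorm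
  have h2 : antidiagonalConstant G ≤ amenabilityConstant (FourierAlgebra G) := by
    rw [hAD]
    exact le_iInf₂ fun M hM => FourierAlgebra.fsNorm_indicator_adiag_le hM
  have h3 : amenabilityConstant (FourierAlgebra G) ≤
      (Nat.card G : ℝ≥0∞)⁻¹ * ∑' π : UnitaryDual G, (π.dim : ℝ≥0∞) ^ 3 := by
    rw [Nat.card_eq_fintype_card]
    exact (iInf₂_le _ (FourierAlgebra.isVirtualDiagonal_diagonal G)).trans
      (FourierAlgebra.enorm_diagonal_le G)
  exact ⟨le_antisymm (h2.trans h3) h1, le_antisymm (h1.trans h2) h3⟩
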